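/- Let $\nu\in(0,1]$ and $n\in\mathbb N$, $n\ge1$, and put $\alpha=\nu/n$; assume $\alpha\in(0,1)$ (that is, $(\nu,n)\neq(1,1)$). For $x\ge0$, $t>0$ let $$l_\alpha(x,t)=t^{-\alpha}\,W_{-\alpha,1-\alpha}(-xt^{-\alpha}),\qquad W_{a,b}(z)=\sum_{k\ge0}\frac{z^k}{k!\,\Gamma(ak+b)},$$ where $1/\Gamma$ is the entire reciprocal Gamma function (zero at $0,-1,-2,\dots$), and let $\Phi_\beta(t)=t^{-\beta}/\Gamma(1-\beta)$ for $t>0$, $\beta\le 1$ (so $\Phi_1=0$ on $(0,\infty)$). Write $D^k_{0-,x}=(-1)^k\partial_x^k$ for integers $k\ge0$, and let $D^\nu_{0+,t}$ be the Riemann--Liouville derivative $D^\nu_{0+,t}f(t)=\frac1{\Gamma(1-\nu)}\frac{d}{dt}\int_0^t(t-s)^{-\nu}f(s)\,ds$ for $\nu<1$, and $D^1_{0+,t}=d/dt$. Then: 1. If $H$ is an $\alpha$-stable subordinator (a Lévy process with nondecreasing paths, $H(0)=0$ and $\mathbb E e^{-\lambda H(x)}=e^{-x\lambda^\alpha}$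 for $\lambda>0$) and $L(t)=\inf\{x\ge0: H(x)>t\}$ is its inverse, then for every $t>0$ the function $l_\alpha(\cdot,t)$ is nonnegative on $(0,\infty)$ and is the density of the law of $L(t)$. 2. For all $x>0$, $t>0$ the derivatives below exist in the classical sense and $$\bigl(D^n_{0-,x}-D^\nu_{0+,t}\bigr)\,l_{\nu/n}(x,t)=0 .$$ 3. $l_{\nu/n}(x,0)=\delta(x)$: $l_{\nu/n}(\cdot,t)$ is integrable on $(0,\infty)$ for every $t>0$, and $\int_0^\infty\varphi(x)\,l_{\nu/n}(x,t)\,dx\to\varphi(0)$ as $t\downarrow0$ for every bounded continuous $\varphi:\mathbb R\to\mathbb R$. 4. For all $t>0$: $l_{\nu/n}(0,t)=\Phi_{\nu/n}(t)$, and for $0\le k<n$ $$\lim_{x\downarrow0}D^k_{0-,x}\,l_{\nu/n}(x,t)=\Phi_{\nu(k+1)/n}(t).$$ 5. For all $\xi,\lambda>0$, the function $e^{-\xi x-\lambda t}l_{\nu/n}(x,t)$ is integrable on $(0,\infty)^2$ and $$\int_0^\infty e^{-\xi x}\int_0^\infty e^{-\lambda t}\,l_{\nu/n}(x,t)\,dt\,dx=\frac{\lambda^{\nu/n-1}}{\xi+\lambda^{\nu/n}}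 .$$ -/

import Mathlib

open MeasureTheory ProbabilityTheory Set Filter Topology
open scoped NNReal BoundedContinuousFunction

noncomputable section

/-- The Wright function `W_{a,b}(z) = ∑ z ^ k / (k! Γ(a k + b))`. The reciprocal Gamma function is
zero at the poles of `Γ`; this is the value of `(Real.Gamma _)⁻¹` there. -/
def wright (a b z : ℝ) : ℝ :=
  ∑' k : ℕ, z ^ k / (k.factorial : ℝ) * (Real.Gamma (a * k + b))⁻¹

/-- `l_α(x, t) = t ^ (-α) W_{-α, 1-α}(-x t ^ (-α))`, for `0 < α < 1`, `x ≥ 0`, `t > 0`. -/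
def invStableDensity (α x t : ℝ) : ℝ :=
  t ^ (-α) * wright (-α) (1 - α) (-x * t ^ (-α))

/-- `Φ_α(z) = z_+ ^ (-α) / Γ(1 - α)`, with the reciprocal Gamma function read as an entire function
(so `Φ_1 = 0` away from the origin). -/
def fracPhi (α z : ℝ) : ℝ :=
  if 0 < z then (Real.Gamma (1 - α))⁻¹ * z ^ (-α) else 0

/-- The function whose derivative of order `m = ⌈α⌉` is the Riemann–Liouville derivative of order
`α` with base point `0`: the fractional integral of order `m - α`, or `f` itself if `α = m`. -/
def rlPrimitive (α : ℝ) (f : ℝ → ℝ) (z : ℝ) : ℝ :=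
  if α = (⌈α⌉₊ : ℝ) then f z
  else (Real.Gamma (⌈α⌉₊ - α))⁻¹ * ∫ s in (0 : ℝ)..z, (z - s) ^ ((⌈α⌉₊ : ℝ) - α - 1) * f s

/-- The Riemann–Liouville derivative `D^α_{0+} f` at `z > 0`. -/
def rlDeriv (α : ℝ) (f : ℝ → ℝ) (z : ℝ) : ℝ :=
  iteratedDeriv ⌈α⌉₊ (rlPrimitive α f) z

/-- `D^α_{0+} f` exists at `z` in the classical sense: the integral converges near `z`
(when `α` is not an integer) and it can be differentiated `⌈α⌉` times. -/
def RLDifferentiableAt (α : ℝ) (f : ℝ → ℝ) (z : ℝ) : Prop :=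
  (α ≠ (⌈α⌉₊ : ℝ) → ∀ᶠ y in 𝓝 z,
    IntervalIntegrable (fun s => (y - s) ^ ((⌈α⌉₊ : ℝ) - α - 1) * f s) volume 0 y) ∧
  ContDiffAt ℝ (⌈α⌉₊ : ℕ) (rlPrimitive α f) z

/-- The derivative `D^n_{0-} = (-1) ^ n d ^ n / dz ^ n` of integer order. -/
def minusDeriv (n : ℕ) (f : ℝ → ℝ) (z : ℝ) : ℝ :=
  (-1) ^ n * iteratedDeriv n f z

/-- `H` is an `α`-stable subordinator: a Lévy process with nondecreasing right-continuous paths,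
started at `0`, with `E exp(-r H(t)) = exp(-t r ^ α)`. -/
structure IsStableSubordinator {Ω : Type*} [MeasurableSpace Ω] (α : ℝ) (H : ℝ≥0 → Ω → ℝ)
    (P : Measure Ω) : Prop where
  measurable : ∀ t, Measurable (H t)
  start_zero : ∀ᵐ ω ∂P, H 0 ω = 0
  indep_increments : HasIndepIncrements H P
  stationary_increments : ∀ s t : ℝ≥0, IdentDistrib (fun ω => H (s + t) ω - H s ω) (H t) P P
  paths : ∀ᵐ ω ∂P, Monotone (fun t => H t ω) ∧
    ∀ t, ContinuousWithinAt (fun s => H s ω) (Ici t) t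
  laplace : ∀ (t : ℝ≥0) (r : ℝ), 0 < r → ∫ ω, Real.exp (-r * H t ω) ∂P = Real.exp (-t * r ^ α)

/-- The inverse process `L(t) = inf {x ≥ 0 | H(x) > t}`. -/
def inverseProcess {Ω : Type*} (H : ℝ≥0 → Ω → ℝ) (t : ℝ) (ω : Ω) : ℝ :=
  ((sInf {x : ℝ≥0 | t < H x ω} : ℝ≥0) : ℝ)

end

/-! Write `a = ν / n`. Everything rests on one family of ray integrals, `wrightRay a γ x t = π⁻¹ Im
∫ p ^ (γ - 1) exp (t p - x p ^ a) dp`, taken over the ray `arg p = π / (1 + a)`. This angle exceeds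
`π / 2` while `a` times it stays below `π / 2`, so `exp (t p)` decays on the ray for `t > 0` and
`exp (-x p ^ a)` decays for `x > 0`. Expanding `exp (-x p ^ a)` and using the reflection formula
shows that the family equals `t ^ (-γ) W_{-a, 1-γ}(-x t ^ (-a))` (`rpow_neg_mul_wright_eq`); the
density `l_a` is the case `γ = a`.

Operators act on the family by shifting `γ`: `-∂_x` inserts `p ^ a`, hence `γ + a`, and `∂_t`
inserts `p`, hence `γ + 1`. Cauchy's formula gives the Laplace transform in time, `r ^ (γ - 1) exp
(-x r ^ a)` (`integral_exp_neg_mul_wrightRay`). By uniqueness of Laplace transforms the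
Riemann–Liouville derivative of order `ν` therefore shifts `γ` by `ν`. Since `n a = ν`, both sides
of the equation are the same function. At `x = 0` only the first term of the Wright series survives,
which gives the boundary values.

The scaling `l_a(x, t) = t ^ (-a) M(x t ^ (-a))`, the integrability of `M = wrightM a` and `∫ M = 1`
give the initial condition and the double transform. No positivity is used there: integrability
comes from the decay bound `exists_abs_wrightM_le_rpow`.

For the law of `L(t)`, the tail `∫_x^∞ l_a(y, t) dy` and `P(H(x) ≤ t)` have the same Laplace
transform `r⁻¹ exp (-x r ^ a)` in `t`, so they agree (`measureReal_le_eq_tail`). The events `{L(t) ≥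
x}` and `{H(x) ≤ t}` differ only by a limit in `x`, and monotonicity of the paths makes the density
nonnegative. -/

/-! ### Contour shifts in the variable `log p` and the Gamma integral on a ray. -/

/-- Substitution `s = exp σ` in integrals over the positive half-line. -/
lemma integral_exp_smul_comp_exp (g : ℝ → ℂ) :
    ∫ σ : ℝ, Real.exp σ • g (Real.exp σ) = ∫ s in Ioi (0 : ℝ), g s := by
  have h := integral_image_eq_integral_abs_deriv_smul (s := univ) MeasurableSet.univ
    (fun x _ => (Real.hasDerivAt_exp x).hasDerivWithinAt) Real.exp_injective.injOn g
  rw [image_univ, Real.range_exp] at h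
  simpa [abs_of_pos (Real.exp_pos _)] using h.symm

lemma integrable_exp_neg_mul_abs {δ : ℝ} (hδ : 0 < δ) :
    Integrable (fun σ : ℝ => Real.exp (-δ * |σ|)) := by
  rw [← integrableOn_univ, ← Iic_union_Ioi (a := (0 : ℝ)), integrableOn_union]
  constructor
  · refine (integrableOn_exp_mul_Iic hδ 0).congr_fun (fun x hx => ?_) measurableSet_Iic
    simp [abs_of_nonpos (mem_Iic.1 hx)]
  · refine (integrableOn_exp_mul_Ioi (neg_neg_of_pos hδ) 0).congr_fun (fun x hx => ?_)
      measurableSet_Ioi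
    simp [abs_of_pos (mem_Ioi.1 hx)]

lemma Continuous.integrable_of_exp_decay {F : ℝ → ℂ} (hF : Continuous F) {C δ R : ℝ} (hδ : 0 < δ)
    (hb : ∀ σ, R ≤ |σ| → ‖F σ‖ ≤ C * Real.exp (-δ * |σ|)) : Integrable F := by
  refine hF.locallyIntegrable.integrable_of_isBigO_cocompact (g := fun σ => Real.exp (-δ * |σ|))
    ?_ ((integrable_exp_neg_mul_abs hδ).integrableAtFilter _)
  refine Asymptotics.IsBigO.of_bound C ?_
  filter_upwards [tendsto_norm_cocompact_atTop.eventually_ge_atTop R] with σ hσ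
  rw [Real.norm_of_nonneg (Real.exp_pos _).le]
  exact hb σ hσ

/-- The integral of a holomorphic function with exponential decay over a horizontal line does not
change when the line is moved within the strip of holomorphy. -/
lemma integral_horizontal_eq {F : ℂ → ℂ} {ψ C δ R : ℝ} (hψ : 0 ≤ ψ) (hδ : 0 < δ)
    (hF : ∀ w : ℂ, 0 ≤ w.im → w.im ≤ ψ → DifferentiableAt ℂ F w)
    (hb : ∀ w : ℂ, 0 ≤ w.im → w.im ≤ ψ → R ≤ |w.re| → ‖F w‖ ≤ C * Real.exp (-δ * |w.re|)) :
    (∀ τ : ℝ, 0 ≤ τ → τ ≤ ψ → Integrable (fun σ : ℝ => F (σ + τ * Complex.I))) ∧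
    ∫ σ : ℝ, F σ = ∫ σ : ℝ, F (σ + ψ * Complex.I) := by
  have hint : ∀ τ : ℝ, 0 ≤ τ → τ ≤ ψ → Integrable (fun σ : ℝ => F (σ + τ * Complex.I)) := by
    intro τ h0 h1
    refine Continuous.integrable_of_exp_decay (C := C) (R := R) ?_ hδ (fun σ hσ => ?_)
    · rw [continuous_iff_continuousAt]
      intro σ
      exact ContinuousAt.comp (f := fun σ : ℝ => (σ + τ * Complex.I : ℂ))
        (hF _ (by simpa using h0) (by simpa using h1)).continuousAt (by fun_prop)
    · simpa using hb (σ + τ * Complex.I) (by simpa using h0) (by simpa using h1) (by simpa using hσ)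
  refine ⟨hint, ?_⟩
  have hi0 : Integrable (fun σ : ℝ => F σ) := by simpa using hint 0 le_rfl hψ
  have t0 := intervalIntegral_tendsto_integral hi0 tendsto_neg_atTop_atBot tendsto_id
  have t1 := intervalIntegral_tendsto_integral (hint ψ hψ le_rfl) tendsto_neg_atTop_atBot tendsto_id
  -- The vertical sides of the rectangle with corners `-T` and `T + iψ` vanish in the limit; `s =
  -- ±1` selects the side.
  have hv : ∀ s : ℝ, |s| = 1 → Tendsto (fun T : ℝ =>
      ∫ y in (0 : ℝ)..ψ, F ((s * T : ℝ) + y * Complex.I)) atTop (𝓝 0) := by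
    intro s hs
    have hlim : Tendsto (fun T : ℝ => C * Real.exp (-δ * T) * |ψ - 0|) atTop (𝓝 0) := by
      have : Tendsto (fun T : ℝ => Real.exp (-δ * T)) atTop (𝓝 0) :=
        Real.tendsto_exp_atBot.comp (tendsto_id.const_mul_atTop_of_neg (neg_neg_of_pos hδ))
      simpa using (this.const_mul C).mul_const |ψ - 0|
    refine squeeze_zero_norm' ?_ hlim
    filter_upwards [eventually_ge_atTop R, eventually_ge_atTop 0] with T hT hT0
    refine intervalIntegral.norm_integral_le_of_norm_le_const (fun y hy => ?_)
    rw [uIoc_of_le hψ] at hy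
    have habs : |s * T| = T := by rw [abs_mul, hs, one_mul, abs_of_nonneg hT0]
    have := hb ((s * T : ℝ) + y * Complex.I) (by simpa using hy.1.le) (by simpa using hy.2)
      (by simpa [hs, abs_of_nonneg hT0] using hT)
    simpa [hs, abs_of_nonneg hT0] using this
  have key : ∀ T : ℝ, (∫ σ in (-T)..T, F σ) = (∫ σ in (-T)..T, F (σ + ψ * Complex.I)) -
      Complex.I * (∫ y in (0 : ℝ)..ψ, F ((1 * T : ℝ) + y * Complex.I)) +
      Complex.I * (∫ y in (0 : ℝ)..ψ, F ((-1 * T : ℝ) + y * Complex.I)) := by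
    intro T
    have h := Complex.integral_boundary_rect_eq_zero_of_differentiableOn F (-T : ℝ)
      ((T : ℝ) + ψ * Complex.I) (fun w hw => by
        rw [Complex.mem_reProdIm] at hw
        have h2 : w.im ∈ Icc 0 ψ := by simpa [uIcc_of_le hψ] using hw.2
        exact (hF w h2.1 h2.2).differentiableWithinAt)
    simp only [Complex.ofReal_re, Complex.add_re, Complex.mul_re, Complex.I_re, mul_zero,
      Complex.ofReal_im, Complex.I_im, mul_one, sub_self, add_zero, Complex.add_im, Complex.mul_im,
      zero_add, Complex.ofReal_zero, zero_mul, smul_eq_mul] at h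
    simp only [one_mul, neg_one_mul]
    linear_combination h
  have t2 := (t1.sub ((hv 1 (by simp)).const_mul Complex.I)).add
    ((hv (-1) (by simp)).const_mul Complex.I)
  simp only [mul_zero, sub_zero, add_zero] at t2
  refine tendsto_nhds_unique t0 (t2.congr fun T => ?_)
  exact (key T).symm

/-- For `σ ≥ 0`, `exp y ≥ 1 + y + y ^ 2 / 2` leaves the quadratic `2 m σ - c (a σ) ^ 2 / 2`, whose
maximum is the constant in the bound. For `σ ≤ 0` the subtracted exponential is simply dropped. -/
lemma exp_linear_sub_exp_le {m c a : ℝ} (hm : 0 < m) (hc : 0 < c) (ha : 0 < a) (σ : ℝ) :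
    Real.exp (m * σ - c * Real.exp (a * σ)) ≤
      Real.exp (2 * m ^ 2 / (c * a ^ 2)) * Real.exp (-m * |σ|) := by
  rw [← Real.exp_add]
  refine Real.exp_le_exp.2 ?_
  have hpos : 0 < c * Real.exp (a * σ) := by positivity
  have hK : 0 ≤ 2 * m ^ 2 / (c * a ^ 2) := by positivity
  rcases le_total σ 0 with h | h
  · rw [abs_of_nonpos h]; linarith
  · rw [abs_of_nonneg h]
    have h1 := Real.quadratic_le_exp_of_nonneg (x := a * σ) (by positivity)
    have h2 : c * (1 + a * σ + (a * σ) ^ 2 / 2) ≤ c * Real.exp (a * σ) :=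
      mul_le_mul_of_nonneg_left h1 hc.le
    have h3 : 0 ≤ c * (a * σ) := by positivity
    have h4 : 2 * m * σ ≤ 2 * m ^ 2 / (c * a ^ 2) + c * (a * σ) ^ 2 / 2 := by
      have : 2 * m ^ 2 / (c * a ^ 2) + c * (a * σ) ^ 2 / 2 - 2 * m * σ
          = (2 * m - c * a ^ 2 * σ) ^ 2 / (2 * (c * a ^ 2)) := by field_simp; ring
      have : 0 ≤ (2 * m - c * a ^ 2 * σ) ^ 2 / (2 * (c * a ^ 2)) := by positivity
      linarith
    nlinarith

lemma ofReal_rpow_sub_one_mul_exp_eq (γ s : ℝ) (hs : 0 < s) :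
    (s : ℂ) * ((s ^ (γ - 1) : ℝ) : ℂ) = Complex.exp (γ * Real.log s) := by
  rw [← Complex.ofReal_mul, Real.rpow_def_of_pos hs, ← Complex.ofReal_mul, ← Complex.ofReal_exp]
  congr 1
  nth_rewrite 1 [← Real.exp_log hs]
  rw [← Real.exp_add]; ring_nf

/-- The Gamma integral over a ray at angle `ψ`, with the exponential decaying along it. -/
lemma integral_ray_rpow_mul_exp {m t ψ : ℝ} (hm : 0 < m) (ht : 0 < t) (h1 : Real.pi / 2 < ψ)
    (h2 : ψ < Real.pi) :
    ∫ s in Ioi (0 : ℝ), ((s ^ (m - 1) : ℝ) : ℂ) * Complex.exp (m * ψ * Complex.I) *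
      Complex.exp (t * s * Complex.exp (ψ * Complex.I)) =
      Complex.exp (m * Real.pi * Complex.I) * ((Real.Gamma m * t ^ (-m) : ℝ) : ℂ) := by
  set F : ℂ → ℂ := fun w => Complex.exp (m * (w + ψ * Complex.I) +
    t * Complex.exp (w + ψ * Complex.I)) with hF
  have hc : 0 < -Real.cos ψ := by
    have := Real.cos_neg_of_pi_div_two_lt_of_lt h1 (by linarith)
    linarith
  -- Rotate the ray from angle `ψ` to `π`, where the integral is the real Gamma integral up to a
  -- phase. In between, the cosine stays below `cos ψ < 0`.
  have hrot := (integral_horizontal_eq (F := F) (ψ := Real.pi - ψ) (δ := m) (R := 0)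
    (C := Real.exp (2 * m ^ 2 / ((t * -Real.cos ψ) * 1 ^ 2))) (by linarith) hm
    (fun w _ _ => by fun_prop) (fun w h0 h1' _ => by
      refine le_trans ?_ (exp_linear_sub_exp_le hm (mul_pos ht hc) one_pos w.re)
      rw [hF, Complex.norm_exp]
      refine Real.exp_le_exp.2 ?_
      have hcos : Real.cos (w.im + ψ) ≤ Real.cos ψ :=
        Real.cos_le_cos_of_nonneg_of_le_pi (by linarith [Real.pi_pos]) (by linarith) (by linarith)
      have := mul_le_mul_of_nonneg_left hcos (mul_pos ht (Real.exp_pos w.re)).le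
      simp [Complex.exp_re]
      linarith)).2
  rw [← integral_exp_smul_comp_exp]
  trans ∫ σ : ℝ, F σ
  · refine integral_congr_ae (Eventually.of_forall fun σ => ?_)
    have h := ofReal_rpow_sub_one_mul_exp_eq m (Real.exp σ) (Real.exp_pos σ)
    simp only [Complex.real_smul, hF]
    rw [← mul_assoc, ← mul_assoc, h, Real.log_exp, ← Complex.exp_add, ← Complex.exp_add,
      Complex.exp_add (σ : ℂ) (ψ * Complex.I), Complex.ofReal_exp]
    congr 1; ring
  rw [hrot]
  trans ∫ σ : ℝ, Complex.exp (m * Real.pi * Complex.I) * (Real.exp σ •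
    (((Real.exp σ) ^ (m - 1) * Real.exp (-(t * Real.exp σ)) : ℝ) : ℂ))
  · refine integral_congr_ae (Eventually.of_forall fun σ => ?_)
    have h := ofReal_rpow_sub_one_mul_exp_eq m (Real.exp σ) (Real.exp_pos σ)
    have e : (σ : ℂ) + ((Real.pi - ψ : ℝ) : ℂ) * Complex.I + ψ * Complex.I
        = σ + Real.pi * Complex.I := by push_cast; ring
    simp only [Complex.real_smul, hF, e]
    rw [Complex.ofReal_mul, ← mul_assoc (Real.exp σ : ℂ), h, Real.log_exp, Complex.ofReal_exp,
      ← Complex.exp_add, ← Complex.exp_add, Complex.exp_add (σ : ℂ), Complex.exp_pi_mul_I]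
    push_cast
    congr 1; ring
  rw [integral_const_mul, integral_exp_smul_comp_exp (fun s => ((s ^ (m - 1) *
    Real.exp (-(t * s)) : ℝ) : ℂ)), integral_complex_ofReal, Real.integral_rpow_mul_exp_neg_mul_Ioi hm ht]
  rw [one_div, Real.inv_rpow ht.le, Real.rpow_neg ht.le, mul_comm (Real.Gamma m)]

/-! ### Cauchy's formula on a sector, with the pole on its boundary. -/

lemma exists_exp_far {r : ℝ} (hr : 0 < r) :
    ∃ R : ℝ, 0 ≤ R ∧ (∀ σ, R ≤ σ → 2 * r ≤ Real.exp σ) ∧ ∀ σ, σ ≤ -R → Real.exp σ ≤ r / 2 := by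
  refine ⟨|Real.log (2 * r)| + |Real.log (r / 2)|, by positivity, fun σ h => ?_, fun σ h => ?_⟩
  · rw [← Real.log_le_iff_le_exp (by positivity)]
    linarith [le_abs_self (Real.log (2 * r)), abs_nonneg (Real.log (r / 2))]
  · rw [← Real.le_log_iff_exp_le (by positivity)]
    linarith [neg_abs_le (Real.log (r / 2)), abs_nonneg (Real.log (2 * r))]

lemma le_norm_add_and_sub {r : ℝ} (hr : 0 < r) (p : ℂ) :
    ‖p‖ - r ≤ ‖r + p‖ ∧ ‖p‖ - r ≤ ‖p - r‖ ∧ r - ‖p‖ ≤ ‖r + p‖ ∧ r - ‖p‖ ≤ ‖p - r‖ := by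
  have h1 := norm_sub_norm_le p (-(r : ℂ))
  have h2 := norm_sub_norm_le p (r : ℂ)
  have h3 := norm_sub_norm_le (r : ℂ) (-p)
  have h4 := norm_sub_norm_le (r : ℂ) p
  rw [norm_sub_rev] at h4
  simp only [norm_neg, Complex.norm_real, Real.norm_of_nonneg hr.le, sub_neg_eq_add] at h1 h2 h3 h4
  rw [add_comm] at h1
  exact ⟨h1, h2, h3, h4⟩

lemma add_exp_ne_zero {r : ℝ} (hr : 0 < r) {w : ℂ} (h0 : -Real.pi < w.im) (h1 : w.im < Real.pi) :
    (r : ℂ) + Complex.exp w ≠ 0 := by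
  intro h
  have e : Complex.exp w = Complex.exp (Real.log r + Real.pi * Complex.I) := by
    rw [Complex.exp_add, Complex.exp_pi_mul_I, ← Complex.ofReal_exp, Real.exp_log hr]
    linear_combination h
  have := Complex.exp_inj_of_neg_pi_lt_of_le_pi h0 h1.le (by simp; linarith [Real.pi_pos])
    (by simp) e
  have := congrArg Complex.im this
  simp at this
  linarith

lemma exp_sub_eq_zero {r : ℝ} (hr : 0 < r) {w : ℂ} (h0 : -Real.pi < w.im) (h1 : w.im < Real.pi)
    (h : Complex.exp w - r = 0) : w = Real.log r := by
  refine Complex.exp_inj_of_neg_pi_lt_of_le_pi h0 h1.le (by simp [Real.pi_pos])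
    (by simp [Real.pi_pos.le]) ?_
  rw [← Complex.ofReal_exp, Real.exp_log hr]
  linear_combination h

/-- Boundary values of `log` along a line in the upper half-plane. -/
lemma integral_line_reference {r ψ : ℝ} (hr : 0 < r) (h0 : 0 < ψ) (hψ : ψ < Real.pi) :
    Integrable (fun σ : ℝ => 2 * Complex.exp (σ + ψ * Complex.I) /
      ((r + Complex.exp (σ + ψ * Complex.I)) * (Complex.exp (σ + ψ * Complex.I) - r))) ∧
    ∫ σ : ℝ, 2 * Complex.exp (σ + ψ * Complex.I) /
      ((r + Complex.exp (σ + ψ * Complex.I)) * (Complex.exp (σ + ψ * Complex.I) - r)) =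
      -(Real.pi / r * Complex.I) := by
  have hn : ∀ σ : ℝ, ‖Complex.exp (σ + ψ * Complex.I)‖ = Real.exp σ := fun σ => by
    simp [Complex.norm_exp]
  have hr0 : (r : ℂ) ≠ 0 := by exact_mod_cast hr.ne'
  have ha : ∀ σ : ℝ, (r : ℂ) + Complex.exp (σ + ψ * Complex.I) ≠ 0 := fun σ =>
    add_exp_ne_zero hr (by simp; linarith [Real.pi_pos]) (by simpa using hψ)
  have hs : ∀ σ : ℝ, Complex.exp (σ + ψ * Complex.I) - r ≠ 0 := fun σ h => by
    have := congrArg Complex.im (exp_sub_eq_zero hr (by simp; linarith [Real.pi_pos])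
      (by simpa using hψ) h)
    simp at this
    linarith
  obtain ⟨R, hR, hR1, hR2⟩ := exists_exp_far hr
  have hint : Integrable (fun σ : ℝ => 2 * Complex.exp (σ + ψ * Complex.I) /
      ((r + Complex.exp (σ + ψ * Complex.I)) * (Complex.exp (σ + ψ * Complex.I) - r))) := by
    refine Continuous.integrable_of_exp_decay (C := 8 + 8 / r ^ 2) (δ := 1) (R := R) ?_ one_pos
      (fun σ hσ => ?_)
    · exact Continuous.div (by fun_prop) (by fun_prop) fun σ => mul_ne_zero (ha σ) (hs σ)
    · obtain ⟨b1, b2, b3, b4⟩ := le_norm_add_and_sub hr (Complex.exp (σ + ψ * Complex.I))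
      rw [hn] at b1 b2 b3 b4
      rw [norm_div, norm_mul, norm_mul, hn, Complex.norm_ofNat]
      have hy := Real.exp_pos σ
      rcases le_total 0 σ with h | h
      · rw [abs_of_nonneg h] at hσ ⊢
        have hb := hR1 σ hσ
        have : (Real.exp σ / 2) * (Real.exp σ / 2) ≤ ‖(r : ℂ) + Complex.exp (σ + ψ * Complex.I)‖ *
            ‖Complex.exp (σ + ψ * Complex.I) - r‖ :=
          mul_le_mul (by linarith) (by linarith) (by positivity) (norm_nonneg _)
        calc _ ≤ 2 * Real.exp σ / ((Real.exp σ / 2) * (Real.exp σ / 2)) := by gcongr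
          _ = 8 * Real.exp (-1 * σ) := by
            rw [neg_one_mul, Real.exp_neg]; field_simp; norm_num
          _ ≤ _ := by gcongr; linarith [show 0 ≤ 8 / r ^ 2 by positivity]
      · rw [abs_of_nonpos h] at hσ ⊢
        have hb := hR2 σ (by linarith)
        have : (r / 2) * (r / 2) ≤ ‖(r : ℂ) + Complex.exp (σ + ψ * Complex.I)‖ *
            ‖Complex.exp (σ + ψ * Complex.I) - r‖ :=
          mul_le_mul (by linarith) (by linarith) (by positivity) (norm_nonneg _)
        calc _ ≤ 2 * Real.exp σ / ((r / 2) * (r / 2)) := by gcongr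
          _ = 8 / r ^ 2 * Real.exp (-1 * -σ) := by
            rw [neg_one_mul, neg_neg]; field_simp; norm_num
          _ ≤ _ := by gcongr; linarith
  refine ⟨hint, ?_⟩
  -- Here `q = (exp w - r) / (exp w + r)` stays in the upper half-plane, so `r⁻¹ log q` is a
  -- primitive that never crosses the branch cut. It runs from `r⁻¹ log (-1) = iπ / r` to `0`.
  set q : ℝ → ℂ := fun σ => 1 - 2 * r / (r + Complex.exp (σ + ψ * Complex.I)) with hq
  have hqim : ∀ σ, 0 < (q σ).im := fun σ => by
    have : (2 * (r : ℂ)) = ((2 * r : ℝ) : ℂ) := by push_cast; rfl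
    have hsin : 0 < Real.sin ψ := Real.sin_pos_of_pos_of_lt_pi h0 hψ
    have hnn : 0 < Complex.normSq (r + Complex.exp (σ + ψ * Complex.I)) :=
      Complex.normSq_pos.2 (ha σ)
    have : (q σ).im = 2 * r * (Real.exp σ * Real.sin ψ /
        Complex.normSq (r + Complex.exp (σ + ψ * Complex.I))) := by
      simp only [hq, this, div_eq_mul_inv]
      rw [Complex.sub_im, Complex.im_ofReal_mul, Complex.inv_im]
      simp [Complex.exp_im]
      ring
    rw [this]; positivity
  have hlim1 : Tendsto (fun σ => (1 / r : ℂ) * Complex.log (q σ)) atBot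
      (𝓝 ((1 / r : ℂ) * (Real.pi * Complex.I))) := by
    refine Tendsto.const_mul _ ?_
    have hc := Complex.continuousWithinAt_log_of_re_neg_of_im_zero (z := -1) (by simp) (by simp)
    have hq1 : Tendsto q atBot (𝓝 (-1)) := by
      have he : Tendsto (fun σ : ℝ => Complex.exp (σ + ψ * Complex.I)) atBot (𝓝 0) := by
        rw [tendsto_zero_iff_norm_tendsto_zero]
        simpa only [hn] using Real.tendsto_exp_atBot
      have : Tendsto q atBot (𝓝 (1 - 2 * r / (r + 0))) :=
        tendsto_const_nhds.sub (tendsto_const_nhds.div (tendsto_const_nhds.add he)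
          (by simpa using hr.ne'))
      convert this using 2
      rw [add_zero, mul_div_assoc, div_self hr0]; norm_num
    have := (hc.tendsto).comp (tendsto_nhdsWithin_iff.2 ⟨hq1, Eventually.of_forall
      fun σ => (hqim σ).le⟩)
    rw [Complex.log_neg_one] at this
    exact this
  have hlim2 : Tendsto (fun σ => (1 / r : ℂ) * Complex.log (q σ)) atTop (𝓝 ((1 / r : ℂ) * 0)) := by
    refine Tendsto.const_mul _ ?_
    have hq1 : Tendsto q atTop (𝓝 1) := by
      have he : Tendsto (fun σ : ℝ => 2 * (r : ℂ) / (r + Complex.exp (σ + ψ * Complex.I))) atTop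
          (𝓝 0) := by
        refine squeeze_zero_norm' (a := fun σ => 4 * r * Real.exp (-σ)) ?_ ?_
        · filter_upwards [eventually_ge_atTop R] with σ hσ
          obtain ⟨b1, -, -, -⟩ := le_norm_add_and_sub hr (Complex.exp (σ + ψ * Complex.I))
          rw [hn] at b1
          have hb := hR1 σ hσ
          have hy := Real.exp_pos σ
          rw [norm_div, norm_mul, Complex.norm_ofNat, Complex.norm_real, Real.norm_of_nonneg hr.le]
          calc _ ≤ 2 * r / (Real.exp σ / 2) := by gcongr; linarith
            _ = _ := by rw [Real.exp_neg]; field_simp; norm_num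
        · simpa using (Real.tendsto_exp_atBot.comp tendsto_neg_atTop_atBot).const_mul (4 * r)
      simpa using tendsto_const_nhds.sub he
    have hc := continuousAt_clog (x := 1) (by simp)
    have := hc.tendsto.comp hq1
    rwa [Complex.log_one] at this
  have hd : ∀ σ : ℝ, HasDerivAt (fun σ => (1 / r : ℂ) * Complex.log (q σ))
      (2 * Complex.exp (σ + ψ * Complex.I) /
      ((r + Complex.exp (σ + ψ * Complex.I)) * (Complex.exp (σ + ψ * Complex.I) - r))) σ := by
    intro σ
    have e1 : HasDerivAt (fun σ : ℝ => Complex.exp (σ + ψ * Complex.I))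
        (Complex.exp (σ + ψ * Complex.I)) σ := by
      simpa using (((hasDerivAt_id σ).ofReal_comp).add_const (ψ * Complex.I)).cexp
    have e2 : HasDerivAt q _ σ :=
      ((hasDerivAt_const σ (2 * (r : ℂ))).div (e1.const_add (r : ℂ)) (ha σ)).const_sub 1
    have e3 := (e2.clog_real (Or.inr (hqim σ).ne')).const_mul (1 / r : ℂ)
    refine e3.congr_deriv ?_
    have hqe : q σ = (Complex.exp (σ + ψ * Complex.I) - r) /
        (r + Complex.exp (σ + ψ * Complex.I)) := by
      simp only [hq]; rw [eq_div_iff (ha σ), sub_mul, div_mul_cancel₀ _ (ha σ)]; ring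
    simp only [hqe]
    have := ha σ
    have := hs σ
    field_simp
    ring
  rw [integral_of_hasDerivAt_of_tendsto hd hint hlim1 hlim2]
  field_simp; ring

/-- Cauchy's formula on a sector for `p ^ (γ - 1) * exp (-x p ^ a)`, in the variable `log p`. -/
lemma im_integral_line_eq {γ x a r ψ : ℝ} (hγ : 0 < γ) (hx : 0 < x) (ha : 0 < a) (hr : 0 < r)
    (h0 : 0 < ψ) (hψ : ψ < Real.pi) (haψ : a * ψ < Real.pi / 2) :
    (∫ σ : ℝ, Complex.exp (γ * (σ + ψ * Complex.I) - x * Complex.exp (a * (σ + ψ * Complex.I))) /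
      (r - Complex.exp (σ + ψ * Complex.I))).im =
      Real.pi / r * Real.exp (γ * Real.log r - x * Real.exp (a * Real.log r)) := by
  set g : ℂ → ℂ := fun w => Complex.exp (γ * w - x * Complex.exp (a * w)) with hg
  set κ : ℝ := Real.exp (γ * Real.log r - x * Real.exp (a * Real.log r)) with hκ
  have hκ0 : 0 < κ := Real.exp_pos _
  -- Reference function with `h (log r) = 1`: subtracting `κ h` cancels the pole of `g / (exp w -
  -- r)` on the real line. The factor `exp w` makes `h` vanish at `-∞`, where `exp w - r` does not
  -- grow.
  set h : ℂ → ℂ := fun w => 2 * Complex.exp w / (r + Complex.exp w) with hh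
  set N : ℂ → ℂ := fun w => g w - κ * h w with hN
  set w₀ : ℂ := (Real.log r : ℂ) with hw₀
  have hr0 : (r : ℂ) ≠ 0 := by exact_mod_cast hr.ne'
  have hew₀ : Complex.exp w₀ = r := by rw [hw₀, ← Complex.ofReal_exp, Real.exp_log hr]
  have hN0 : N w₀ = 0 := by
    simp only [hN, hg, hh, hew₀, hκ]
    have : 2 * (r : ℂ) / (r + r) = 1 := by field_simp; norm_num
    rw [this]; simp [hw₀]
  -- The quotient of divided differences is `N / (exp w - r)` with its removable singularity at `w₀`
  -- filled in.
  set F : ℂ → ℂ := fun w => dslope N w₀ w / dslope Complex.exp w₀ w with hF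
  have hFeq : ∀ w, w ≠ w₀ → F w = N w / (Complex.exp w - r) := by
    intro w hw
    have : w - w₀ ≠ 0 := sub_ne_zero.2 hw
    simp only [hF, dslope_of_ne _ hw, slope_def_field, hN0, hew₀, sub_zero]
    rw [div_div_div_cancel_right₀ this]
  set U : Set ℂ := {w | -Real.pi < w.im ∧ w.im < Real.pi} with hU
  have hUo : IsOpen U := (isOpen_lt continuous_const Complex.continuous_im).inter
    (isOpen_lt Complex.continuous_im continuous_const)
  have hw₀U : w₀ ∈ U := by simp [hU, hw₀, Real.pi_pos]
  have hNd : DifferentiableOn ℂ N U := by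
    intro w hw
    have := add_exp_ne_zero hr hw.1 hw.2
    have : DifferentiableAt ℂ N w := by
      simp only [hN, hg, hh]
      fun_prop (disch := assumption)
    exact this.differentiableWithinAt
  have hFd : ∀ w ∈ U, DifferentiableAt ℂ F w := by
    intro w hw
    have d1 := ((Complex.differentiableOn_dslope (hUo.mem_nhds hw₀U)).2 hNd).differentiableAt
      (hUo.mem_nhds hw)
    have d2 := ((Complex.differentiableOn_dslope (hUo.mem_nhds hw₀U)).2
      (Complex.differentiable_exp.differentiableOn)).differentiableAt (hUo.mem_nhds hw)
    refine d1.div d2 ?_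
    by_cases hw' : w = w₀
    · rw [hw', dslope_same, Complex.deriv_exp]; exact Complex.exp_ne_zero _
    · rw [dslope_of_ne _ hw', slope_def_field, hew₀]
      exact div_ne_zero (fun h => hw' (exp_sub_eq_zero hr hw.1 hw.2 h)) (sub_ne_zero.2 hw')
  obtain ⟨R, hR, hR1, hR2⟩ := exists_exp_far hr
  have hcos : 0 < Real.cos (a * ψ) :=
    Real.cos_pos_of_mem_Ioo ⟨by linarith [Real.pi_pos, mul_pos ha h0], haψ⟩
  set K : ℝ := Real.exp (2 * γ ^ 2 / ((x * Real.cos (a * ψ)) * a ^ 2)) with hK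
  have hK0 : 0 < K := Real.exp_pos _
  have hgb : ∀ w : ℂ, 0 ≤ w.im → w.im ≤ ψ → ‖g w‖ ≤ K * Real.exp (-γ * |w.re|) := by
    intro w h1 h2
    refine le_trans ?_ (exp_linear_sub_exp_le hγ (mul_pos hx hcos) ha w.re)
    rw [hg, Complex.norm_exp]
    refine Real.exp_le_exp.2 ?_
    have : Real.cos (a * ψ) ≤ Real.cos (a * w.im) :=
      Real.cos_le_cos_of_nonneg_of_le_pi (by positivity) (by linarith [Real.pi_pos]) (by gcongr)
    have := mul_le_mul_of_nonneg_left this (mul_pos hx (Real.exp_pos (a * w.re))).le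
    simp [Complex.exp_re]
    linarith
  set δ : ℝ := min γ 1 with hδ
  have hδ0 : 0 < δ := lt_min hγ one_pos
  have hFb : ∀ w : ℂ, 0 ≤ w.im → w.im ≤ ψ → R + 1 + |Real.log r| ≤ |w.re| →
      ‖F w‖ ≤ (2 * (K + 4 * κ) + 2 / r * (K + 4 * κ / r)) * Real.exp (-δ * |w.re|) := by
    intro w h1 h2 hw
    have hne : w ≠ w₀ := fun h => by
      rw [h, hw₀, Complex.ofReal_re] at hw
      linarith
    have hwR : R ≤ |w.re| := by linarith [abs_nonneg (Real.log r)]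
    have hn : ‖Complex.exp w‖ = Real.exp w.re := Complex.norm_exp w
    obtain ⟨b1, b2, b3, b4⟩ := le_norm_add_and_sub hr (Complex.exp w)
    rw [hn] at b1 b2 b3 b4
    have hy := Real.exp_pos w.re
    have hnh : ‖N w‖ ≤ ‖g w‖ + κ * (2 * Real.exp w.re / ‖r + Complex.exp w‖) := by
      refine (norm_sub_le _ _).trans_eq ?_
      rw [norm_mul, norm_div, norm_mul, hn, Complex.norm_real, Real.norm_of_nonneg hκ0.le,
        Complex.norm_ofNat]
    have hg1 := hgb w h1 h2
    have hexpδ : Real.exp (-1 * |w.re|) ≤ Real.exp (-δ * |w.re|) :=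
      Real.exp_le_exp.2 (mul_le_mul_of_nonneg_right (neg_le_neg (min_le_right _ _)) (abs_nonneg _))
    have hexpγ : Real.exp (-γ * |w.re|) ≤ Real.exp (-δ * |w.re|) :=
      Real.exp_le_exp.2 (mul_le_mul_of_nonneg_right (neg_le_neg (min_le_left _ _)) (abs_nonneg _))
    rw [hFeq w hne, norm_div]
    rcases le_total 0 w.re with h | h
    · have hb := hR1 w.re (by rwa [abs_of_nonneg h] at hwR)
      have h3 : ‖N w‖ ≤ K + 4 * κ := by
        have e1 : 2 * Real.exp w.re / ‖r + Complex.exp w‖ ≤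
            2 * Real.exp w.re / (Real.exp w.re / 2) := by gcongr; linarith
        have e2 : 2 * Real.exp w.re / (Real.exp w.re / 2) = 4 := by field_simp; norm_num
        have e3 : Real.exp (-γ * |w.re|) ≤ 1 := by
          rw [Real.exp_le_one_iff, neg_mul, neg_nonpos]; positivity
        nlinarith
      calc ‖N w‖ / ‖Complex.exp w - r‖ ≤ (K + 4 * κ) / (Real.exp w.re / 2) := by
            gcongr; linarith
        _ = (2 * (K + 4 * κ)) * Real.exp (-1 * |w.re|) := by
            rw [abs_of_nonneg h, neg_one_mul, Real.exp_neg]; field_simp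
        _ ≤ (2 * (K + 4 * κ)) * Real.exp (-δ * |w.re|) := by gcongr
        _ ≤ _ := by gcongr; exact le_add_of_nonneg_right (by positivity)
    · have hb := hR2 w.re (by rw [abs_of_nonpos h] at hwR; linarith)
      have h3 : ‖N w‖ ≤ (K + 4 * κ / r) * Real.exp (-δ * |w.re|) := by
        have e1 : 2 * Real.exp w.re / ‖r + Complex.exp w‖ ≤
            2 * Real.exp w.re / (r / 2) := by gcongr; linarith
        have e2 : 2 * Real.exp w.re / (r / 2) = 4 / r * Real.exp (-1 * |w.re|) := by
          rw [abs_of_nonpos h, neg_one_mul, neg_neg]; field_simp; norm_num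
        have e3 : κ * (2 * Real.exp w.re / ‖r + Complex.exp w‖) ≤
            κ * (4 / r * Real.exp (-δ * |w.re|)) := by
          rw [e2] at e1
          gcongr; exact e1.trans (by gcongr)
        have e4 : K * Real.exp (-γ * |w.re|) ≤ K * Real.exp (-δ * |w.re|) := by gcongr
        calc _ ≤ K * Real.exp (-δ * |w.re|) + κ * (4 / r * Real.exp (-δ * |w.re|)) := by linarith
          _ = _ := by ring
      calc ‖N w‖ / ‖Complex.exp w - r‖ ≤
          ((K + 4 * κ / r) * Real.exp (-δ * |w.re|)) / (r / 2) := by gcongr; linarith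
        _ = (2 / r * (K + 4 * κ / r)) * Real.exp (-δ * |w.re|) := by field_simp
        _ ≤ _ := by gcongr; exact le_add_of_nonneg_left (by positivity)
  obtain ⟨hFi, hrot⟩ := integral_horizontal_eq h0.le hδ0 (fun w h1 h2 => hFd w
    ⟨by linarith [Real.pi_pos], by linarith⟩) hFb
  -- On the real line `F` is real, so the imaginary part on the shifted line comes from the
  -- reference integral alone.
  have hreal : (∫ σ : ℝ, F σ).im = 0 := by
    have : (fun σ : ℝ => F σ) =ᵐ[volume] fun σ : ℝ => (((Real.exp (γ * σ - x * Real.exp (a * σ)) -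
        κ * (2 * Real.exp σ / (r + Real.exp σ))) / (Real.exp σ - r) : ℝ) : ℂ) := by
      filter_upwards [compl_mem_ae_iff.2 (measure_singleton (μ := volume) (Real.log r))] with σ hσ
      rw [hFeq _ (by simpa [hw₀] using hσ)]
      simp [hN, hg, hh]
    rw [integral_congr_ae this, integral_complex_ofReal, Complex.ofReal_im]
  obtain ⟨hi, hv⟩ := integral_line_reference hr h0 hψ
  have hψi := hFi ψ h0.le le_rfl
  have e : ∀ σ : ℝ, g (σ + ψ * Complex.I) / (r - Complex.exp (σ + ψ * Complex.I)) =
      -F (σ + ψ * Complex.I) - κ * (2 * Complex.exp (σ + ψ * Complex.I) /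
      ((r + Complex.exp (σ + ψ * Complex.I)) * (Complex.exp (σ + ψ * Complex.I) - r))) := by
    intro σ
    have hne : (σ : ℂ) + ψ * Complex.I ≠ w₀ := fun h => by
      have := congrArg Complex.im h
      simp [hw₀] at this
      linarith
    have h1 := add_exp_ne_zero (w := σ + ψ * Complex.I) hr (by simp; linarith [Real.pi_pos])
      (by simpa using hψ)
    have h2 : Complex.exp (σ + ψ * Complex.I) - r ≠ 0 := fun h => hne (exp_sub_eq_zero hr
      (by simp; linarith [Real.pi_pos]) (by simpa using hψ) h)
    have h3 : r - Complex.exp (σ + ψ * Complex.I) ≠ 0 := fun h => h2 (by linear_combination -h)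
    rw [hFeq _ hne]
    simp only [hN, hh]
    field_simp
    ring
  rw [integral_congr_ae (Eventually.of_forall e)]
  rw [integral_sub (f := fun σ : ℝ => -F (σ + ψ * Complex.I)) hψi.neg (hi.const_mul _), integral_neg, integral_const_mul, hv, ← hrot]
  simp [hreal]
  ring

/-! ### The ray integral and its identification with the Wright function. -/

/-- The angle of the ray of integration in the integral representation of the Wright function. -/
noncomputable def rayAngle (a : ℝ) : ℝ := Real.pi / (1 + a)

lemma rayAngle_bounds {a : ℝ} (h0 : 0 < a) (h1 : a < 1) :
    Real.pi / 2 < rayAngle a ∧ rayAngle a < Real.pi ∧ a * rayAngle a < Real.pi / 2 := by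
  have hp := Real.pi_pos
  unfold rayAngle
  refine ⟨?_, ?_, ?_⟩
  · gcongr; linarith
  · rw [div_lt_iff₀ (by linarith)]; nlinarith
  · rw [← mul_div_assoc, div_lt_div_iff₀ (by linarith) two_pos]; nlinarith

lemma cos_rayAngle_neg {a : ℝ} (h0 : 0 < a) (h1 : a < 1) : 0 < -Real.cos (rayAngle a) := by
  obtain ⟨h2, h3, -⟩ := rayAngle_bounds h0 h1
  have := Real.cos_neg_of_pi_div_two_lt_of_lt h2 (by linarith)
  linarith

lemma cos_mul_rayAngle_pos {a : ℝ} (h0 : 0 < a) (h1 : a < 1) : 0 < Real.cos (a * rayAngle a) := by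
  obtain ⟨h2, h3, h4⟩ := rayAngle_bounds h0 h1
  exact Real.cos_pos_of_mem_Ioo ⟨by nlinarith [Real.pi_pos], h4⟩

/-- The integrand in the integral representation of `t ^ (-γ) W_{-a, 1-γ}(-x t ^ (-a))`. -/
noncomputable def wrightKernel (a γ x t s : ℝ) : ℂ :=
  ((s ^ (γ - 1) : ℝ) : ℂ) * Complex.exp (γ * rayAngle a * Complex.I) *
    Complex.exp (t * s * Complex.exp (rayAngle a * Complex.I) -
      x * ((s ^ a : ℝ) : ℂ) * Complex.exp (a * rayAngle a * Complex.I))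

/-- The integral representation of `t ^ (-γ) W_{-a, 1-γ}(-x t ^ (-a))`. -/
noncomputable def wrightRay (a γ x t : ℝ) : ℝ :=
  Real.pi⁻¹ * (∫ s in Ioi (0 : ℝ), wrightKernel a γ x t s).im

lemma measurable_wrightKernel (a γ x t : ℝ) : Measurable (wrightKernel a γ x t) := by
  unfold wrightKernel; fun_prop

lemma norm_wrightKernel (a γ x t : ℝ) {s : ℝ} (hs : 0 < s) :
    ‖wrightKernel a γ x t s‖ = s ^ (γ - 1) *
      Real.exp (-x * Real.cos (a * rayAngle a) * s ^ a - t * -Real.cos (rayAngle a) * s) := by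
  have e1 : (γ * rayAngle a * Complex.I : ℂ) = ((γ * rayAngle a : ℝ) : ℂ) * Complex.I := by
    push_cast; rfl
  have e2 : (a * rayAngle a * Complex.I : ℂ) = ((a * rayAngle a : ℝ) : ℂ) * Complex.I := by
    push_cast; rfl
  have e3 : (t * s * Complex.exp (rayAngle a * Complex.I) - x * ((s ^ a : ℝ) : ℂ) *
      Complex.exp (((a * rayAngle a : ℝ) : ℂ) * Complex.I)).re =
      -x * Real.cos (a * rayAngle a) * s ^ a - t * -Real.cos (rayAngle a) * s := by
    rw [← Complex.ofReal_mul, ← Complex.ofReal_mul, Complex.sub_re, Complex.re_ofReal_mul,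
      Complex.re_ofReal_mul, Complex.exp_ofReal_mul_I_re, Complex.exp_ofReal_mul_I_re]
    ring
  unfold wrightKernel
  rw [norm_mul, norm_mul, e1, e2, Complex.norm_exp_ofReal_mul_I, Complex.norm_exp, e3,
    Complex.norm_real, Real.norm_of_nonneg (by positivity), mul_one]

lemma exists_mul_rpow_le {a y c : ℝ} (h0 : 0 < a) (h1 : a < 1) (hy : 0 ≤ y) (hc : 0 < c) :
    ∃ K, ∀ s, 0 < s → y * s ^ a ≤ K + c * s := by
  have hlim : Tendsto (fun S : ℝ => y * S ^ (-(1 - a))) atTop (𝓝 (y * 0)) :=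
    (tendsto_rpow_neg_atTop (by linarith)).const_mul y
  rw [mul_zero] at hlim
  -- Since `a < 1`, some scale `S` satisfies `y S ^ (a - 1) ≤ c`; then `u ^ a ≤ 1 + u` is applied to
  -- `u = s / S`.
  obtain ⟨S, hS, hS0⟩ := ((hlim.eventually_le_const hc).and (eventually_gt_atTop 0)).exists
  refine ⟨y * S ^ a, fun s hs => ?_⟩
  have hu : (s / S) ^ a ≤ 1 + s / S := by
    have hpos : 0 < s / S := by positivity
    rcases le_total (s / S) 1 with h | h
    · linarith [Real.rpow_le_one hpos.le h h0.le]
    · have := Real.rpow_le_rpow_of_exponent_le h h1.le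
      rw [Real.rpow_one] at this
      linarith
  have e1 : s ^ a = (s / S) ^ a * S ^ a := by
    rw [← Real.mul_rpow (by positivity) hS0.le, div_mul_cancel₀ _ hS0.ne']
  have e2 : S ^ (-(1 - a)) = S ^ a / S := by
    rw [neg_sub, Real.rpow_sub_one hS0.ne']
  calc y * s ^ a ≤ y * ((1 + s / S) * S ^ a) := by rw [e1]; gcongr
    _ = y * S ^ a + (y * S ^ (-(1 - a))) * s := by rw [e2]; field_simp
    _ ≤ _ := by gcongr

lemma integrableOn_rpow_mul_exp_mul_rpow_sub {a γ y c : ℝ} (h0 : 0 < a) (h1 : a < 1) (hγ : 0 < γ)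
    (hy : 0 ≤ y) (hc : 0 < c) :
    IntegrableOn (fun s : ℝ => s ^ (γ - 1) * Real.exp (y * s ^ a - c * s)) (Ioi 0) := by
  obtain ⟨K, hK⟩ := exists_mul_rpow_le h0 h1 hy (half_pos hc)
  have hi := (integrableOn_rpow_mul_exp_neg_mul_rpow (s := γ - 1) (p := 1) (b := c / 2)
    (by linarith) one_pos (half_pos hc)).const_mul (Real.exp K)
  refine Integrable.mono' hi (by fun_prop) ?_
  filter_upwards [ae_restrict_mem measurableSet_Ioi] with s hs
  have hs : 0 < s := hs
  rw [Real.norm_of_nonneg (by positivity), mul_left_comm, ← Real.exp_add, Real.rpow_one]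
  gcongr
  linarith [hK s hs]

lemma integrableOn_wrightKernel {a γ x t : ℝ} (h0 : 0 < a) (h1 : a < 1) (hγ : 0 < γ) (ht : 0 < t) :
    IntegrableOn (wrightKernel a γ x t) (Ioi 0) := by
  refine Integrable.mono' (integrableOn_rpow_mul_exp_mul_rpow_sub h0 h1 hγ (abs_nonneg x)
    (mul_pos ht (cos_rayAngle_neg h0 h1))) (measurable_wrightKernel a γ x t).aestronglyMeasurable ?_
  filter_upwards [ae_restrict_mem measurableSet_Ioi] with s hs
  have hs : 0 < s := hs
  rw [norm_wrightKernel a γ x t hs]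
  have : -x * Real.cos (a * rayAngle a) ≤ |x| := by
    have h2 := Real.cos_le_one (a * rayAngle a)
    have h3 := cos_mul_rayAngle_pos h0 h1
    nlinarith [neg_abs_le x, abs_nonneg x]
  gcongr

/-- Euler's reflection formula. It persists at positive integers `m`, where the sine vanishes and
`Real.Gamma` takes the value `0` at its poles, in agreement with the entire function `1 / Γ`. -/
lemma inv_Gamma_one_sub {m : ℝ} (hm : 0 < m) :
    (Real.Gamma (1 - m))⁻¹ = Real.pi⁻¹ * (Real.Gamma m * Real.sin (Real.pi * m)) := by
  have h := Real.Gamma_mul_Gamma_one_sub m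
  have hG := (Real.Gamma_pos_of_pos hm).ne'
  by_cases hs : Real.sin (Real.pi * m) = 0
  · rw [hs, div_zero] at h
    rw [(mul_eq_zero.1 h).resolve_left hG, hs]; simp
  · have h1 : Real.Gamma (1 - m) = Real.pi / Real.sin (Real.pi * m) / Real.Gamma m := by
      rw [eq_div_iff hG, mul_comm, h]
    rw [h1]; field_simp

/-- The Wright function as an integral over a ray. -/
lemma rpow_neg_mul_wright_eq {a γ x t : ℝ} (h0 : 0 < a) (h1 : a < 1) (hγ : 0 < γ) (ht : 0 < t) :
    t ^ (-γ) * wright (-a) (1 - γ) (-x * t ^ (-a)) = wrightRay a γ x t := by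
  obtain ⟨p1, p2, -⟩ := rayAngle_bounds h0 h1
  set c := t * -Real.cos (rayAngle a) with hc
  have hc0 : 0 < c := mul_pos ht (cos_rayAngle_neg h0 h1)
  have hm : ∀ k : ℕ, 0 < γ + a * k := fun k => by positivity
  set F : ℕ → ℝ → ℂ := fun k s => (((-x) ^ k / (k.factorial : ℝ) : ℝ) : ℂ) *
    (((s ^ (γ + a * k - 1) : ℝ) : ℂ) * Complex.exp ((γ + a * k : ℝ) * rayAngle a * Complex.I) *
      Complex.exp (t * s * Complex.exp (rayAngle a * Complex.I))) with hF
  have hpow : ∀ (k : ℕ) (s : ℝ), 0 < s → s ^ (γ + a * k - 1) = s ^ (γ - 1) * (s ^ a) ^ k := by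
    intro k s hs
    rw [← Real.rpow_mul_natCast hs.le, ← Real.rpow_add hs]; ring_nf
  have hnexp : ∀ s : ℝ, ‖Complex.exp (t * s * Complex.exp (rayAngle a * Complex.I))‖ =
      Real.exp (-c * s) := by
    intro s
    rw [Complex.norm_exp, ← Complex.ofReal_mul, Complex.re_ofReal_mul, Complex.exp_ofReal_mul_I_re,
      hc]
    ring_nf
  -- Expand `exp (-x p ^ a)` and integrate term by term. The absolute series sums to `s ^ (γ - 1)
  -- exp (|x| s ^ a - c s)`, integrable because `a < 1`.
  have hsum : HasSum (fun k => ∫ s in Ioi (0 : ℝ), F k s)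
      (∫ s in Ioi (0 : ℝ), wrightKernel a γ x t s) := by
    refine hasSum_integral_of_dominated_convergence (fun k s => s ^ (γ - 1) * Real.exp (-c * s) *
      ((|x| * s ^ a) ^ k / k.factorial)) (fun k => ?_) (fun k => ?_) ?_ ?_ ?_
    · exact Measurable.aestronglyMeasurable (by simp only [hF]; fun_prop)
    · filter_upwards [ae_restrict_mem measurableSet_Ioi] with s hs
      have hs : 0 < s := hs
      rw [hF]
      simp only [norm_mul, hnexp, Complex.norm_real]
      rw [← Complex.ofReal_mul, Complex.norm_exp_ofReal_mul_I, norm_div, norm_pow, norm_neg,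
        Real.norm_eq_abs, Real.norm_of_nonneg (by positivity : 0 ≤ s ^ (γ + a * k - 1)),
        hpow k s hs, Real.norm_of_nonneg (by positivity), mul_pow]
      apply le_of_eq; ring
    · exact Eventually.of_forall fun s => (Real.summable_pow_div_factorial _).mul_left _
    · refine (integrableOn_rpow_mul_exp_mul_rpow_sub h0 h1 hγ (abs_nonneg x) hc0).congr_fun
        (fun s _ => ?_) measurableSet_Ioi
      rw [tsum_mul_left]
      have : ∑' k : ℕ, (|x| * s ^ a) ^ k / (k.factorial : ℝ) = Real.exp (|x| * s ^ a) := by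
        rw [Real.exp_eq_exp_ℝ, NormedSpace.exp_eq_tsum_div]
      rw [this, mul_assoc, ← Real.exp_add]; ring_nf
    · filter_upwards [ae_restrict_mem measurableSet_Ioi] with s hs
      have hs : 0 < s := hs
      have he := (NormedSpace.expSeries_div_hasSum_exp (-x * ((s ^ a : ℝ) : ℂ) *
        Complex.exp (a * rayAngle a * Complex.I))).mul_left (((s ^ (γ - 1) : ℝ) : ℂ) *
          Complex.exp (γ * rayAngle a * Complex.I) *
          Complex.exp (t * s * Complex.exp (rayAngle a * Complex.I)))
      rw [← Complex.exp_eq_exp_ℂ] at he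
      have e1 : wrightKernel a γ x t s = ((s ^ (γ - 1) : ℝ) : ℂ) *
          Complex.exp (γ * rayAngle a * Complex.I) *
          Complex.exp (t * s * Complex.exp (rayAngle a * Complex.I)) *
          Complex.exp (-x * ((s ^ a : ℝ) : ℂ) * Complex.exp (a * rayAngle a * Complex.I)) := by
        rw [mul_assoc _ (Complex.exp (t * s * _)), ← Complex.exp_add, wrightKernel]; ring_nf
      rw [e1]
      refine he.congr_fun fun k => ?_
      simp only [hF]
      rw [hpow k s hs, mul_pow, mul_pow, ← Complex.exp_nat_mul]
      have : Complex.exp ((γ + a * k : ℝ) * rayAngle a * Complex.I) =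
          Complex.exp (γ * rayAngle a * Complex.I) *
            Complex.exp (k * (a * rayAngle a * Complex.I)) := by
        rw [← Complex.exp_add]; push_cast; ring_nf
      rw [this]; push_cast; ring
  -- The phase `exp (iπ(γ + a k))` of the ray integral has imaginary part `sin (π(γ + a k))`, which
  -- reflection turns into a reciprocal Gamma value.
  have hterm : ∀ k : ℕ, (∫ s in Ioi (0 : ℝ), F k s).im =
      Real.pi * (t ^ (-γ) * ((-x * t ^ (-a)) ^ k / (k.factorial : ℝ) *
        (Real.Gamma (-a * k + (1 - γ)))⁻¹)) := by
    intro k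
    have e : -a * k + (1 - γ) = 1 - (γ + a * k) := by ring
    simp only [hF]
    rw [integral_const_mul, integral_ray_rpow_mul_exp (hm k) ht p1 p2, e, inv_Gamma_one_sub (hm k),
      Complex.im_ofReal_mul, Complex.im_mul_ofReal, ← Complex.ofReal_mul,
      Complex.exp_ofReal_mul_I_im, mul_pow, ← Real.rpow_mul_natCast ht.le, neg_add,
      Real.rpow_add ht]
    have := Real.pi_pos.ne'
    field_simp
  have hsum' := (Complex.hasSum_im hsum).mul_left Real.pi⁻¹
  simp_rw [hterm, inv_mul_cancel_left₀ Real.pi_pos.ne'] at hsum'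
  rw [wrightRay, ← hsum'.tsum_eq, tsum_mul_left, wright]

lemma hasDerivAt_wrightKernel_left (a γ x t : ℝ) {s : ℝ} (hs : 0 < s) :
    HasDerivAt (fun y => wrightKernel a γ y t s) (-wrightKernel a (γ + a) x t s) x := by
  have h1 : HasDerivAt (fun y : ℝ => (t * s * Complex.exp (rayAngle a * Complex.I) -
      y * ((s ^ a : ℝ) : ℂ) * Complex.exp (a * rayAngle a * Complex.I) : ℂ))
      (-(1 * ((s ^ a : ℝ) : ℂ) * Complex.exp (a * rayAngle a * Complex.I))) x :=
    (((hasDerivAt_id x).ofReal_comp.mul_const _).mul_const _).const_sub _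
  refine (h1.cexp.const_mul (((s ^ (γ - 1) : ℝ) : ℂ) *
    Complex.exp (γ * rayAngle a * Complex.I))).congr_deriv ?_
  have e1 : s ^ (γ + a - 1) = s ^ (γ - 1) * s ^ a := by rw [← Real.rpow_add hs]; ring_nf
  have e2 : Complex.exp ((γ + a : ℝ) * rayAngle a * Complex.I) =
      Complex.exp (γ * rayAngle a * Complex.I) * Complex.exp (a * rayAngle a * Complex.I) := by
    rw [← Complex.exp_add]; push_cast; ring_nf
  rw [wrightKernel, e1, e2]
  push_cast
  ring

lemma hasDerivAt_wrightKernel_right (a γ x t : ℝ) {s : ℝ} (hs : 0 < s) :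
    HasDerivAt (fun u => wrightKernel a γ x u s) (wrightKernel a (γ + 1) x t s) t := by
  have h1 : HasDerivAt (fun u : ℝ => (u * s * Complex.exp (rayAngle a * Complex.I) -
      x * ((s ^ a : ℝ) : ℂ) * Complex.exp (a * rayAngle a * Complex.I) : ℂ))
      (1 * s * Complex.exp (rayAngle a * Complex.I)) t :=
    (((hasDerivAt_id t).ofReal_comp.mul_const _).mul_const _).sub_const _
  refine (h1.cexp.const_mul (((s ^ (γ - 1) : ℝ) : ℂ) *
    Complex.exp (γ * rayAngle a * Complex.I))).congr_deriv ?_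
  have e1 : s ^ (γ + 1 - 1) = s ^ (γ - 1) * s := by
    rw [add_sub_cancel_right, Real.rpow_sub_one hs.ne']; field_simp
  have e2 : Complex.exp ((γ + 1 : ℝ) * rayAngle a * Complex.I) =
      Complex.exp (γ * rayAngle a * Complex.I) * Complex.exp (rayAngle a * Complex.I) := by
    rw [← Complex.exp_add]; push_cast; ring_nf
  rw [wrightKernel, e1, e2]
  push_cast
  ring

lemma abs_wrightRay_le {a γ x t : ℝ} {b : ℝ → ℝ}
    (hb : IntegrableOn b (Ioi 0)) (hle : ∀ s, 0 < s → s ^ (γ - 1) *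
      Real.exp (-x * Real.cos (a * rayAngle a) * s ^ a - t * -Real.cos (rayAngle a) * s) ≤ b s) :
    |wrightRay a γ x t| ≤ Real.pi⁻¹ * ∫ s in Ioi (0 : ℝ), b s := by
  rw [wrightRay, abs_mul, abs_of_pos (inv_pos.2 Real.pi_pos)]
  gcongr
  refine (Complex.abs_im_le_norm _).trans (norm_integral_le_of_norm_le hb ?_)
  filter_upwards [ae_restrict_mem measurableSet_Ioi] with s hs
  rw [norm_wrightKernel a γ x t hs]
  exact hle s hs

/-! ### Derivatives and time Laplace transform of the ray integrals. -/

section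
variable {a γ : ℝ} (h0 : 0 < a) (h1 : a < 1) (hγ : 0 < γ)
include h0 h1 hγ

/-- Differentiation inserts `-p ^ a`. As `exp (t p)` dominates any `exp (y s ^ a)`, this works for
every real `x`; the case `x = 0` is needed for the boundary limits. -/
lemma hasDerivAt_wrightRay_left {t : ℝ} (ht : 0 < t) (x : ℝ) :
    HasDerivAt (fun y => wrightRay a γ y t) (-wrightRay a (γ + a) x t) x := by
  have hk := cos_mul_rayAngle_pos h0 h1
  have hi := integrableOn_rpow_mul_exp_mul_rpow_sub h0 h1 (add_pos hγ h0)
    (by positivity : 0 ≤ |x| + 1) (mul_pos ht (cos_rayAngle_neg h0 h1))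
  have hd := (hasDerivAt_integral_of_dominated_loc_of_deriv_le (μ := volume.restrict (Ioi (0 : ℝ)))
    (F := fun y s => wrightKernel a γ y t s) (F' := fun y s => -wrightKernel a (γ + a) y t s)
    (x₀ := x) (s := Metric.ball x 1) (Metric.ball_mem_nhds x one_pos)
    (Eventually.of_forall fun y => (measurable_wrightKernel a γ y t).aestronglyMeasurable)
    (integrableOn_wrightKernel h0 h1 hγ ht)
    (measurable_wrightKernel a (γ + a) x t).neg.aestronglyMeasurable ?_ hi ?_).2
  · have := (Complex.imCLM.hasFDerivAt.comp_hasDerivAt x hd).const_mul Real.pi⁻¹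
    refine this.congr_deriv ?_
    rw [integral_neg]
    simp [wrightRay]
  · filter_upwards [ae_restrict_mem measurableSet_Ioi] with s hs y hy
    have hs : 0 < s := hs
    rw [norm_neg, norm_wrightKernel a _ y t hs]
    have hy' : -y ≤ |x| + 1 := by
      have := abs_lt.1 (Real.dist_eq y x ▸ Metric.mem_ball.1 hy)
      linarith [neg_abs_le x]
    have : -y * Real.cos (a * rayAngle a) ≤ |x| + 1 := by
      have h2 := Real.cos_le_one (a * rayAngle a)
      nlinarith [abs_nonneg x]
    gcongr
  · filter_upwards [ae_restrict_mem measurableSet_Ioi] with s hs y _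
    exact hasDerivAt_wrightKernel_left a γ y t hs

lemma hasDerivAt_wrightRay_right (x : ℝ) {t : ℝ} (ht : 0 < t) :
    HasDerivAt (fun u => wrightRay a γ x u) (wrightRay a (γ + 1) x t) t := by
  have hk := cos_mul_rayAngle_pos h0 h1
  have hA := cos_rayAngle_neg h0 h1
  have hi := integrableOn_rpow_mul_exp_mul_rpow_sub h0 h1 (add_pos hγ one_pos)
    (abs_nonneg x) (mul_pos (half_pos ht) hA)
  have hd := (hasDerivAt_integral_of_dominated_loc_of_deriv_le (μ := volume.restrict (Ioi (0 : ℝ)))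
    (F := fun u s => wrightKernel a γ x u s) (F' := fun u s => wrightKernel a (γ + 1) x u s)
    (x₀ := t) (s := Ioi (t / 2)) (Ioi_mem_nhds (half_lt_self ht))
    (Eventually.of_forall fun u => (measurable_wrightKernel a γ x u).aestronglyMeasurable)
    (integrableOn_wrightKernel h0 h1 hγ ht)
    (measurable_wrightKernel a (γ + 1) x t).aestronglyMeasurable ?_ hi ?_).2
  · exact (Complex.imCLM.hasFDerivAt.comp_hasDerivAt t hd).const_mul Real.pi⁻¹
  · filter_upwards [ae_restrict_mem measurableSet_Ioi] with s hs u hu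
    have hs : 0 < s := hs
    have hu : t / 2 < u := hu
    rw [norm_wrightKernel a _ x u hs]
    have : -x * Real.cos (a * rayAngle a) ≤ |x| := by
      have h2 := Real.cos_le_one (a * rayAngle a)
      nlinarith [neg_abs_le x, abs_nonneg x]
    gcongr
  · filter_upwards [ae_restrict_mem measurableSet_Ioi] with s hs y _
    exact hasDerivAt_wrightKernel_right a γ x y hs

lemma iteratedDeriv_wrightRay_left {t : ℝ} (ht : 0 < t) (k : ℕ) :
    iteratedDeriv k (fun y => wrightRay a γ y t) =
      fun y => (-1) ^ k * wrightRay a (γ + k * a) y t := by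
  induction k with
  | zero => simp
  | succ k ih =>
    rw [iteratedDeriv_succ, ih]
    ext y
    have := ((hasDerivAt_wrightRay_left h0 h1 (γ := γ + k * a) (by positivity) ht y).const_mul
      ((-1 : ℝ) ^ k)).deriv
    rw [this]
    push_cast
    rw [show γ + k * a + a = γ + (k + 1) * a by ring]
    ring

lemma contDiff_wrightRay_left {t : ℝ} (ht : 0 < t) {m : ℕ∞} :
    ContDiff ℝ m (fun y => wrightRay a γ y t) := by
  refine contDiff_of_differentiable_iteratedDeriv fun k _ => ?_
  rw [iteratedDeriv_wrightRay_left h0 h1 hγ ht]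
  exact Differentiable.const_mul (fun y => (hasDerivAt_wrightRay_left h0 h1 (by positivity) ht
    y).differentiableAt) _

/-- For `x > 0` the factor `exp (-x p ^ a)` alone makes the integral converge. The bound is uniform
down to `t = 0`, so Laplace transforms and fractional integrals in time converge. -/
lemma exists_abs_wrightRay_le_of_pos {x : ℝ} (hx : 0 < x) :
    ∃ C, ∀ t, 0 ≤ t → |wrightRay a γ x t| ≤ C := by
  have hk := mul_pos hx (cos_mul_rayAngle_pos h0 h1)
  have hA := cos_rayAngle_neg h0 h1
  refine ⟨_, fun t ht => abs_wrightRay_le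
    (integrableOn_rpow_mul_exp_neg_mul_rpow (s := γ - 1) (p := a) (by linarith) h0 hk)
    fun s hs => ?_⟩
  have : 0 ≤ t * -Real.cos (rayAngle a) * s := by positivity
  gcongr
  linarith

/-- The Laplace transform in time of `t ^ (-γ) W_{-a, 1-γ}(-x t ^ (-a))`. -/
lemma integral_exp_neg_mul_wrightRay {x r : ℝ} (hx : 0 < x) (hr : 0 < r) :
    ∫ t in Ioi (0 : ℝ), Real.exp (-r * t) * wrightRay a γ x t =
      r ^ (γ - 1) * Real.exp (-x * r ^ a) := by
  have hk := mul_pos hx (cos_mul_rayAngle_pos h0 h1)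
  have hA := cos_rayAngle_neg h0 h1
  obtain ⟨p1, p2, p3⟩ := rayAngle_bounds h0 h1
  have hint : Integrable (Function.uncurry fun t s : ℝ => ((Real.exp (-r * t) : ℝ) : ℂ) *
      wrightKernel a γ x t s) ((volume.restrict (Ioi 0)).prod (volume.restrict (Ioi 0))) := by
    have hb := (integrableOn_exp_mul_Ioi (neg_neg_of_pos hr) 0).mul_prod
      (integrableOn_rpow_mul_exp_neg_mul_rpow (s := γ - 1) (p := a) (by linarith) h0 hk)
    refine hb.mono' (Measurable.aestronglyMeasurable ?_) ?_
    · unfold Function.uncurry wrightKernel; fun_prop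
    · rw [Measure.prod_restrict]
      filter_upwards [ae_restrict_mem (measurableSet_Ioi.prod measurableSet_Ioi)] with p hp
      have h3 : 0 < p.1 := hp.1
      have h4 : 0 < p.2 := hp.2
      simp only [Function.uncurry]
      rw [norm_mul, norm_wrightKernel a γ x _ h4, Complex.norm_real,
        Real.norm_of_nonneg (Real.exp_pos _).le]
      have : 0 ≤ p.1 * -Real.cos (rayAngle a) * p.2 := by positivity
      gcongr
      linarith
  have e1 : ∫ t in Ioi (0 : ℝ), Real.exp (-r * t) * wrightRay a γ x t = Real.pi⁻¹ *
      (∫ t in Ioi (0 : ℝ), ∫ s in Ioi (0 : ℝ), ((Real.exp (-r * t) : ℝ) : ℂ) *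
        wrightKernel a γ x t s).im := by
    have : ∀ t : ℝ, Real.exp (-r * t) * wrightRay a γ x t = Real.pi⁻¹ *
        Complex.imCLM (∫ s in Ioi (0 : ℝ), ((Real.exp (-r * t) : ℝ) : ℂ) *
          wrightKernel a γ x t s) := by
      intro t
      rw [integral_const_mul, Complex.imCLM_apply, Complex.im_ofReal_mul, wrightRay]
      ring
    simp_rw [this]
    have hc := Complex.imCLM.integral_comp_comm (φ := fun t : ℝ => ∫ s in Ioi (0 : ℝ),
      ((Real.exp (-r * t) : ℝ) : ℂ) * wrightKernel a γ x t s) hint.integral_prod_left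
    rw [integral_const_mul, hc]
    rfl
  rw [e1, integral_integral_swap hint]
  -- The inner integral of `exp ((p - r) t)` is `1 / (r - p)`; with `s = exp σ` the outer one
  -- becomes the line integral of `im_integral_line_eq`.
  have e2 : ∫ s in Ioi (0 : ℝ), ∫ t in Ioi (0 : ℝ), ((Real.exp (-r * t) : ℝ) : ℂ) *
        wrightKernel a γ x t s = ∫ σ : ℝ, Complex.exp (γ * (σ + rayAngle a * Complex.I) -
          x * Complex.exp (a * (σ + rayAngle a * Complex.I))) /
          (r - Complex.exp (σ + rayAngle a * Complex.I)) := by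
    rw [← integral_exp_smul_comp_exp]
    refine integral_congr_ae (Eventually.of_forall fun σ => ?_)
    set s := Real.exp σ with hs
    have hs0 : 0 < s := Real.exp_pos σ
    have hre : (s * Complex.exp (rayAngle a * Complex.I) - r).re < 0 := by
      rw [Complex.sub_re, Complex.re_ofReal_mul, Complex.exp_ofReal_mul_I_re, Complex.ofReal_re]
      nlinarith
    have e3 : ∀ t : ℝ, ((Real.exp (-r * t) : ℝ) : ℂ) * wrightKernel a γ x t s =
        ((s ^ (γ - 1) : ℝ) : ℂ) * Complex.exp (γ * rayAngle a * Complex.I) *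
        Complex.exp (-x * ((s ^ a : ℝ) : ℂ) * Complex.exp (a * rayAngle a * Complex.I)) *
        Complex.exp ((s * Complex.exp (rayAngle a * Complex.I) - r) * t) := by
      intro t
      rw [mul_assoc _ (Complex.exp (-x * _ * _)), ← Complex.exp_add, wrightKernel, mul_left_comm,
        Complex.ofReal_exp, ← Complex.exp_add]
      push_cast; ring_nf
    have e8 := integral_congr_ae (μ := volume.restrict (Ioi (0 : ℝ))) (Eventually.of_forall e3)
    rw [integral_const_mul, integral_exp_mul_complex_Ioi hre] at e8
    have e4 : Complex.exp (σ + rayAngle a * Complex.I) =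
        s * Complex.exp (rayAngle a * Complex.I) := by
      rw [Complex.exp_add, hs, Complex.ofReal_exp]
    have e5 : Complex.exp (a * (σ + rayAngle a * Complex.I)) =
        ((s ^ a : ℝ) : ℂ) * Complex.exp (a * rayAngle a * Complex.I) := by
      rw [hs, ← Real.exp_mul, mul_add, Complex.exp_add]; push_cast; ring_nf
    have e6 := ofReal_rpow_sub_one_mul_exp_eq γ s hs0
    rw [hs, Real.log_exp, ← hs] at e6
    have e7 : Complex.exp (γ * (σ + rayAngle a * Complex.I) -
          x * Complex.exp (a * (σ + rayAngle a * Complex.I))) =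
        s * ((s ^ (γ - 1) : ℝ) : ℂ) * Complex.exp (γ * rayAngle a * Complex.I) *
        Complex.exp (-x * ((s ^ a : ℝ) : ℂ) * Complex.exp (a * rayAngle a * Complex.I)) := by
      rw [e6, ← Complex.exp_add, ← Complex.exp_add, e5]; ring_nf
    have hne : (s * Complex.exp (rayAngle a * Complex.I) - r) ≠ 0 := fun h => by
      rw [h] at hre; simp at hre
    have hne' : (r : ℂ) - s * Complex.exp (rayAngle a * Complex.I) ≠ 0 := fun h =>
      hne (by linear_combination -h)
    beta_reduce
    rw [e8, e7, e4, Complex.real_smul, Complex.ofReal_zero, mul_zero, Complex.exp_zero, neg_div,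
      ← div_neg, neg_sub]
    ring
  rw [e2, im_integral_line_eq hγ hx h0 hr (by linarith [Real.pi_pos]) p2 p3]
  rw [show γ * Real.log r - x * Real.exp (a * Real.log r) =
    Real.log r * γ + -x * Real.exp (Real.log r * a) by ring_nf, Real.exp_add,
    ← Real.rpow_def_of_pos hr, ← Real.rpow_def_of_pos hr, Real.rpow_sub_one hr.ne']
  have := Real.pi_pos.ne'
  field_simp

end

/-! ### The M-Wright function: scaling, decay, total mass, initial condition. -/

/-- The M-Wright function `W_{-a, 1-a}(-z)`. -/
noncomputable def wrightM (a z : ℝ) : ℝ := wright (-a) (1 - a) (-z)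

lemma invStableDensity_eq_wrightM (a x t : ℝ) :
    invStableDensity a x t = t ^ (-a) * wrightM a (x * t ^ (-a)) := by
  rw [invStableDensity, wrightM, neg_mul]

lemma integral_Ioi_invStableDensity (a x : ℝ) {t : ℝ} (ht : 0 < t) :
    ∫ y in Ioi x, invStableDensity a y t = ∫ z in Ioi (x * t ^ (-a)), wrightM a z := by
  have hc : 0 < t ^ (-a) := by positivity
  simp_rw [invStableDensity_eq_wrightM]
  rw [integral_const_mul, integral_comp_mul_right_Ioi _ _ hc, smul_eq_mul,
    mul_inv_cancel_left₀ hc.ne']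

section
variable {a : ℝ} (h0 : 0 < a) (h1 : a < 1)
include h0 h1

lemma invStableDensity_eq_wrightRay (x : ℝ) {t : ℝ} (ht : 0 < t) :
    invStableDensity a x t = wrightRay a a x t :=
  rpow_neg_mul_wright_eq h0 h1 h0 ht

lemma wrightM_eq_wrightRay (z : ℝ) : wrightM a z = wrightRay a a z 1 := by
  rw [← rpow_neg_mul_wright_eq h0 h1 h0 one_pos, wrightM]
  simp

lemma continuous_wrightM : Continuous (wrightM a) := by
  rw [funext (wrightM_eq_wrightRay h0 h1)]
  exact continuous_iff_continuousAt.2 fun z =>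
    (hasDerivAt_wrightRay_left h0 h1 h0 one_pos z).continuousAt

/-- At `t = 0` the integrand is the derivative of `-exp (-x p ^ a) / (a x)` along the ray. What
matters is that the value is real. -/
lemma integral_wrightKernel_zero {x : ℝ} (hx : 0 < x) :
    ∫ s in Ioi (0 : ℝ), wrightKernel a a x 0 s = ((1 / (a * x) : ℝ) : ℂ) := by
  have hk := mul_pos hx (cos_mul_rayAngle_pos h0 h1)
  have hi : IntegrableOn (wrightKernel a a x 0) (Ioi 0) := by
    refine (integrableOn_rpow_mul_exp_neg_mul_rpow (s := a - 1) (by linarith) h0 hk).mono'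
      (measurable_wrightKernel a a x 0).aestronglyMeasurable ?_
    filter_upwards [ae_restrict_mem measurableSet_Ioi] with s hs
    rw [norm_wrightKernel a a x 0 hs]
    apply le_of_eq; ring_nf
  set f : ℝ → ℂ := fun s => -((1 / (a * x) : ℝ) : ℂ) *
    Complex.exp (-x * ((s ^ a : ℝ) : ℂ) * Complex.exp (a * rayAngle a * Complex.I)) with hf
  have hd : ∀ s ∈ Ioi (0 : ℝ), HasDerivAt f (wrightKernel a a x 0 s) s := by
    intro s hs
    have hs : 0 < s := hs
    have e := ((Real.hasDerivAt_rpow_const (p := a) (Or.inl hs.ne')).ofReal_comp.const_mul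
      (-x : ℂ)).mul_const (Complex.exp (a * rayAngle a * Complex.I))
    refine (e.cexp.const_mul (-((1 / (a * x) : ℝ) : ℂ))).congr_deriv ?_
    have ha0 : (a : ℂ) ≠ 0 := by exact_mod_cast h0.ne'
    have hx0 : (x : ℂ) ≠ 0 := by exact_mod_cast hx.ne'
    rw [wrightKernel]
    push_cast
    field_simp
    simp
    ring
  have hc : ContinuousWithinAt f (Ici 0) 0 := by
    have : Continuous fun s : ℝ => s ^ a := Real.continuous_rpow_const h0.le
    exact Continuous.continuousWithinAt (by fun_prop)
  have hl : Tendsto f atTop (𝓝 0) := by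
    have hn : ∀ s, ‖f s‖ = 1 / (a * x) * Real.exp (-(x * Real.cos (a * rayAngle a) * s ^ a)) := by
      intro s
      have e2 : (a * rayAngle a * Complex.I : ℂ) = ((a * rayAngle a : ℝ) : ℂ) * Complex.I := by
        push_cast; rfl
      rw [hf, norm_mul, norm_neg, Complex.norm_real, Real.norm_of_nonneg (by positivity),
        Complex.norm_exp, e2, neg_mul, ← Complex.ofReal_mul, neg_mul, Complex.neg_re,
        Complex.re_ofReal_mul, Complex.exp_ofReal_mul_I_re]
      ring_nf
    rw [tendsto_zero_iff_norm_tendsto_zero]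
    simp_rw [hn]
    have := (Real.tendsto_exp_neg_atTop_nhds_zero.comp ((tendsto_rpow_atTop h0).const_mul_atTop
      hk)).const_mul (1 / (a * x))
    simpa using this
  rw [integral_Ioi_of_hasDerivAt_of_tendsto hc hd hi hl]
  simp [hf, Real.zero_rpow h0.ne']

/-- A direct estimate of the ray integral gives only `1 / x`, which is not integrable. The kernel at
`t = 0` has a real integral, so subtracting it costs nothing, and `|exp p - 1| ≤ 2 |p|` gains a
power of `s`, enough for an exponent `(a + 1) / a > 1`. -/
lemma exists_abs_wrightM_le_rpow :
    ∃ C, ∀ x, 0 < x → |wrightM a x| ≤ C * x ^ (-((a + 1) / a)) := by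
  have hk := cos_mul_rayAngle_pos h0 h1
  have hA := cos_rayAngle_neg h0 h1
  refine ⟨Real.pi⁻¹ * (2 * ((Real.cos (a * rayAngle a)) ^ (-(a + 1) / a) * (1 / a) *
    Real.Gamma ((a + 1) / a))), fun x hx => ?_⟩
  have hkx := mul_pos hx hk
  -- A non-integrable function has integral `0` by convention, whereas this one has integral `1 / (a
  -- x) ≠ 0`.
  have hi0 : IntegrableOn (wrightKernel a a x 0) (Ioi 0) := by
    by_contra h
    have := integral_wrightKernel_zero h0 h1 hx
    rw [integral_undef h] at this
    have h2 : (1 / (a * x) : ℝ) = 0 := by exact_mod_cast this.symm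
    have : 0 < 1 / (a * x) := by positivity
    linarith
  have e : wrightRay a a x 1 = Real.pi⁻¹ *
      (∫ s in Ioi (0 : ℝ), (wrightKernel a a x 1 s - wrightKernel a a x 0 s)).im := by
    rw [integral_sub (integrableOn_wrightKernel h0 h1 h0 one_pos) hi0, Complex.sub_im,
      integral_wrightKernel_zero h0 h1 hx, Complex.ofReal_im, sub_zero, wrightRay]
  have hi := (integrableOn_rpow_mul_exp_neg_mul_rpow (s := a) (p := a) (by linarith) h0
    hkx).const_mul 2
  rw [wrightM_eq_wrightRay h0 h1, e, abs_mul, abs_of_pos (inv_pos.2 Real.pi_pos), mul_assoc]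
  gcongr
  refine (Complex.abs_im_le_norm _).trans ((norm_integral_le_of_norm_le hi ?_).trans_eq ?_)
  · filter_upwards [ae_restrict_mem measurableSet_Ioi] with s hs
    have hs : 0 < s := hs
    have e1 : wrightKernel a a x 1 s - wrightKernel a a x 0 s = wrightKernel a a x 0 s *
        (Complex.exp (s * Complex.exp (rayAngle a * Complex.I)) - 1) := by
      rw [mul_sub, mul_one]
      congr 1
      simp only [wrightKernel]
      rw [mul_assoc _ _ (Complex.exp (s * _)), ← Complex.exp_add]
      congr 2
      push_cast; ring
    have e2 : ‖Complex.exp (s * Complex.exp (rayAngle a * Complex.I)) - 1‖ ≤ 2 * s := by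
      have hz : ‖(s : ℂ) * Complex.exp (rayAngle a * Complex.I)‖ = s := by
        rw [norm_mul, Complex.norm_exp_ofReal_mul_I, Complex.norm_real,
          Real.norm_of_nonneg hs.le, mul_one]
      rcases le_total s 1 with h | h
      · have := Complex.norm_exp_sub_one_le (x := s * Complex.exp (rayAngle a * Complex.I))
          (by rwa [hz])
        rwa [hz] at this
      · refine (norm_sub_le _ _).trans ?_
        have : ‖Complex.exp (s * Complex.exp (rayAngle a * Complex.I))‖ ≤ 1 := by
          rw [Complex.norm_exp, Complex.re_ofReal_mul, Complex.exp_ofReal_mul_I_re,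
            Real.exp_le_one_iff]
          nlinarith
        rw [norm_one]; linarith
    rw [e1, norm_mul, norm_wrightKernel a a x 0 hs]
    calc _ ≤ s ^ (a - 1) * Real.exp (-x * Real.cos (a * rayAngle a) * s ^ a -
          0 * -Real.cos (rayAngle a) * s) * (2 * s) := by gcongr
      _ = _ := by
        rw [Real.rpow_sub_one hs.ne', zero_mul, zero_mul, sub_zero]
        field_simp
  · rw [integral_const_mul, integral_rpow_mul_exp_neg_mul_rpow h0 (by linarith) hkx,
      Real.mul_rpow hx.le hk.le, neg_div]
    ring

lemma integrableOn_wrightM : IntegrableOn (wrightM a) (Ioi 0) := by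
  obtain ⟨C, hC⟩ := exists_abs_wrightM_le_rpow h0 h1
  rw [← Ioc_union_Ioi_eq_Ioi zero_le_one, integrableOn_union]
  constructor
  · exact (continuous_wrightM h0 h1).integrableOn_Icc.mono_set Ioc_subset_Icc_self
  · have hi := (integrableOn_Ioi_rpow_of_lt (a := -((a + 1) / a))
      (by rw [neg_lt_neg_iff, lt_div_iff₀ h0]; linarith) one_pos).const_mul C
    refine hi.mono' (continuous_wrightM h0 h1).aestronglyMeasurable ?_
    filter_upwards [ae_restrict_mem measurableSet_Ioi] with x hx
    exact hC x (one_pos.trans hx)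

lemma integrableOn_invStableDensity {t : ℝ} (ht : 0 < t) :
    IntegrableOn (fun x => invStableDensity a x t) (Ioi 0) := by
  have hc : 0 < t ^ (-a) := by positivity
  simp_rw [invStableDensity_eq_wrightM]
  refine Integrable.const_mul ?_ _
  have := (integrableOn_Ioi_comp_mul_right_iff (wrightM a) 0 hc).2
    (by simpa using integrableOn_wrightM h0 h1)
  exact this

lemma measurable_uncurry_invStableDensity :
    Measurable fun p : ℝ × ℝ => invStableDensity a p.1 p.2 := by
  have := (continuous_wrightM h0 h1).measurable
  simp_rw [invStableDensity_eq_wrightM]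
  fun_prop

/-- By scaling, the `L¹` norm of the density in `y` is `∫ |M|`, whatever `t` is; only `exp (-r t)`
remains to be integrated. -/
lemma integrable_exp_mul_invStableDensity {r : ℝ} (hr : 0 < r) :
    Integrable (Function.uncurry fun t y : ℝ => Real.exp (-r * t) * invStableDensity a y t)
      ((volume.restrict (Ioi 0)).prod (volume.restrict (Ioi 0))) := by
  have hm : Measurable (Function.uncurry fun t y : ℝ =>
      Real.exp (-r * t) * invStableDensity a y t) := by
    have := (measurable_uncurry_invStableDensity h0 h1).comp measurable_swap
    exact (by fun_prop : Measurable fun p : ℝ × ℝ => Real.exp (-r * p.1)).mul this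
  rw [integrable_prod_iff hm.aestronglyMeasurable]
  constructor
  · filter_upwards [ae_restrict_mem measurableSet_Ioi] with t ht
    exact Integrable.const_mul (c := Real.exp (-r * t)) (integrableOn_invStableDensity h0 h1 ht)
  · have hi : IntegrableOn (fun t => Real.exp (-r * t) * ∫ z in Ioi (0 : ℝ), |wrightM a z|)
        (Ioi 0) := (integrableOn_exp_mul_Ioi (neg_neg_of_pos hr) 0).mul_const _
    refine hi.congr_fun (fun t ht => ?_) measurableSet_Ioi
    have ht : 0 < t := ht
    have hc : 0 < t ^ (-a) := by positivity
    simp only [Function.uncurry, norm_mul, Real.norm_eq_abs, invStableDensity_eq_wrightM]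
    rw [integral_const_mul, integral_const_mul,
      integral_comp_mul_right_Ioi (fun z => |wrightM a z|) _ hc, smul_eq_mul, abs_of_pos hc,
      mul_inv_cancel_left₀ hc.ne', zero_mul, abs_of_pos (Real.exp_pos _)]

lemma integral_exp_neg_mul_invStableDensity {x r : ℝ} (hx : 0 < x) (hr : 0 < r) :
    ∫ t in Ioi (0 : ℝ), Real.exp (-r * t) * invStableDensity a x t =
      r ^ (a - 1) * Real.exp (-x * r ^ a) := by
  rw [← integral_exp_neg_mul_wrightRay h0 h1 h0 hx hr]
  refine setIntegral_congr_fun measurableSet_Ioi fun t ht => ?_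
  simp only [invStableDensity_eq_wrightRay h0 h1 x ht]

/-- The Laplace transform in time of the tail of the density. -/
lemma integral_exp_neg_mul_tail {x r : ℝ} (hx : 0 ≤ x) (hr : 0 < r) :
    ∫ t in Ioi (0 : ℝ), Real.exp (-r * t) * ∫ y in Ioi x, invStableDensity a y t =
      r⁻¹ * Real.exp (-x * r ^ a) := by
  have hint : Integrable (Function.uncurry fun t y : ℝ =>
      Real.exp (-r * t) * invStableDensity a y t)
      ((volume.restrict (Ioi 0)).prod (volume.restrict (Ioi x))) :=
    (integrable_exp_mul_invStableDensity h0 h1 hr).mono_measure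
      (Measure.prod_mono le_rfl (Measure.restrict_mono (Ioi_subset_Ioi hx) le_rfl))
  simp_rw [← integral_const_mul]
  rw [integral_integral_swap hint]
  have hra : 0 < r ^ a := by positivity
  have : ∫ y in Ioi x, ∫ t in Ioi (0 : ℝ), Real.exp (-r * t) * invStableDensity a y t =
      ∫ y in Ioi x, r ^ (a - 1) * Real.exp (-r ^ a * y) := by
    refine setIntegral_congr_fun measurableSet_Ioi fun y hy => ?_
    simp only [integral_exp_neg_mul_invStableDensity h0 h1 (hx.trans_lt hy) hr]
    ring_nf
  rw [this, integral_const_mul, integral_exp_mul_Ioi (neg_neg_of_pos hra), Real.rpow_sub_one hr.ne',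
    show -r ^ a * x = -x * r ^ a by ring]
  field_simp

/-- By scaling the total mass does not depend on `t`, so the Laplace transform of the tail at `x =
0`, `r = 1` reads it off. -/
lemma integral_wrightM : ∫ z in Ioi (0 : ℝ), wrightM a z = 1 := by
  have h := integral_exp_neg_mul_tail h0 h1 le_rfl one_pos
  have : ∫ t in Ioi (0 : ℝ), Real.exp (-1 * t) * ∫ y in Ioi 0, invStableDensity a y t =
      ∫ t in Ioi (0 : ℝ), Real.exp (-1 * t) * ∫ z in Ioi (0 : ℝ), wrightM a z := by
    refine setIntegral_congr_fun measurableSet_Ioi fun t ht => ?_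
    simp only [integral_Ioi_invStableDensity a 0 ht, zero_mul]
  rw [this, integral_mul_const, integral_exp_mul_Ioi (by norm_num)] at h
  simpa using h

/-- Substituting `z = x t ^ (-a)` moves `t` into `φ (z t ^ a)`, which tends to `φ 0` under the
dominating function `‖φ‖ |M|`. -/
lemma tendsto_integral_mul_invStableDensity (φ : ℝ →ᵇ ℝ) :
    Tendsto (fun t => ∫ x in Ioi (0 : ℝ), φ x * invStableDensity a x t) (𝓝[>] 0) (𝓝 (φ 0)) := by
  have hlim : Tendsto (fun t : ℝ => ∫ z in Ioi (0 : ℝ), φ (z * t ^ a) * wrightM a z) (𝓝[>] 0)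
      (𝓝 (∫ z in Ioi (0 : ℝ), φ 0 * wrightM a z)) := by
    refine tendsto_integral_filter_of_dominated_convergence (fun z => ‖φ‖ * |wrightM a z|)
      (Eventually.of_forall fun t => ?_) (Eventually.of_forall fun t => ?_)
      ((integrableOn_wrightM h0 h1).abs.const_mul _) (Eventually.of_forall fun z => ?_)
    · have := continuous_wrightM h0 h1
      exact Continuous.aestronglyMeasurable (by fun_prop)
    · refine Eventually.of_forall fun z => ?_
      rw [norm_mul, Real.norm_eq_abs (wrightM a z)]
      gcongr
      exact φ.norm_coe_le_norm _
    · refine Tendsto.mul_const _ ((φ.continuous.tendsto 0).comp ?_)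
      have : Continuous fun t : ℝ => z * t ^ a :=
        (Real.continuous_rpow_const h0.le).const_mul z
      have := this.tendsto 0
      rw [Real.zero_rpow h0.ne', mul_zero] at this
      exact this.mono_left nhdsWithin_le_nhds
  rw [integral_const_mul, integral_wrightM h0 h1, mul_one] at hlim
  refine hlim.congr' ?_
  filter_upwards [self_mem_nhdsWithin] with t ht
  have ht : 0 < t := ht
  have hc : 0 < t ^ (-a) := by positivity
  have e := integral_comp_mul_right_Ioi (fun z => φ (z * t ^ a) * wrightM a z) 0 hc
  rw [zero_mul, smul_eq_mul] at e
  rw [← mul_right_inj' (inv_ne_zero hc.ne'), ← e, ← integral_const_mul]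
  refine setIntegral_congr_fun measurableSet_Ioi fun x _ => ?_
  have e2 : x * t ^ (-a) * t ^ a = x := by
    rw [mul_assoc, ← Real.rpow_add ht]; simp
  simp only [invStableDensity_eq_wrightM, e2]
  field_simp

lemma integrable_exp_mul_exp_mul_invStableDensity {ξ r : ℝ} (hξ : 0 < ξ) (hr : 0 < r) :
    Integrable (fun p : ℝ × ℝ =>
        Real.exp (-ξ * p.1) * (Real.exp (-r * p.2) * invStableDensity a p.1 p.2))
      ((volume.restrict (Ioi 0)).prod (volume.restrict (Ioi 0))) := by
  have hm : Measurable fun p : ℝ × ℝ =>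
      Real.exp (-ξ * p.1) * (Real.exp (-r * p.2) * invStableDensity a p.1 p.2) := by
    have := measurable_uncurry_invStableDensity h0 h1
    fun_prop
  refine (integrable_exp_mul_invStableDensity h0 h1 hr).swap.mono hm.aestronglyMeasurable ?_
  rw [Measure.prod_restrict]
  filter_upwards [ae_restrict_mem (measurableSet_Ioi.prod measurableSet_Ioi)] with p hp
  rw [norm_mul]
  refine mul_le_of_le_one_left (norm_nonneg _) ?_
  have : 0 < p.1 := hp.1
  rw [Real.norm_of_nonneg (Real.exp_pos _).le, Real.exp_le_one_iff]
  nlinarith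

lemma integral_exp_mul_integral_exp_mul_invStableDensity {ξ r : ℝ} (hξ : 0 < ξ) (hr : 0 < r) :
    ∫ x in Ioi (0 : ℝ), Real.exp (-ξ * x) *
        ∫ t in Ioi (0 : ℝ), Real.exp (-r * t) * invStableDensity a x t =
      r ^ (a - 1) / (ξ + r ^ a) := by
  have hra : 0 < r ^ a := by positivity
  have : ∫ x in Ioi (0 : ℝ), Real.exp (-ξ * x) *
        ∫ t in Ioi (0 : ℝ), Real.exp (-r * t) * invStableDensity a x t =
      ∫ x in Ioi (0 : ℝ), r ^ (a - 1) * Real.exp (-(ξ + r ^ a) * x) := by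
    refine setIntegral_congr_fun measurableSet_Ioi fun x hx => ?_
    simp only [integral_exp_neg_mul_invStableDensity h0 h1 hx hr]
    rw [mul_left_comm, ← Real.exp_add]; ring_nf
  rw [this, integral_const_mul, integral_exp_mul_Ioi (by linarith)]
  rw [mul_zero, Real.exp_zero, neg_div_neg_eq, mul_one_div]

lemma wrightRay_zero_eq_fracPhi {γ t : ℝ} (hγ : 0 < γ) (ht : 0 < t) :
    wrightRay a γ 0 t = fracPhi γ t := by
  rw [← rpow_neg_mul_wright_eq h0 h1 hγ ht, fracPhi, if_pos ht, wright, tsum_eq_single 0]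
  · simp [mul_comm]
  · intro k hk
    simp [hk]

end

/-! ### Uniqueness for Laplace transforms. -/

/-- A finite measure on `ℝ` is determined by its moment generating function on `(-∞, 1)`. -/
lemma measure_eq_of_mgf_eq_of_lt_one {μ μ' : Measure ℝ} [IsFiniteMeasure μ] [IsFiniteMeasure μ']
    (hμ : ∀ s < 1, Integrable (fun x => Real.exp (s * x)) μ)
    (hμ' : ∀ s < 1, Integrable (fun x => Real.exp (s * x)) μ')
    (h : ∀ s < 1, ∫ x, Real.exp (s * x) ∂μ = ∫ x, Real.exp (s * x) ∂μ') : μ = μ' := by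
  have hsub : ∀ {m : Measure ℝ}, (∀ s < 1, Integrable (fun x => Real.exp (s * x)) m) →
      {z : ℂ | z.re < 1} ⊆ {z : ℂ | z.re ∈ interior (integrableExpSet id m)} := by
    intro m hm z hz
    exact interior_maximal (fun s hs => hm s hs) isOpen_Iio hz
  have hconv : Convex ℝ {z : ℂ | z.re < 1} := convex_halfSpace_re_lt 1
  have heq : EqOn (complexMGF id μ) (complexMGF id μ') {z : ℂ | z.re < 1} := by
    -- Identity theorem on `Re z < 1`: agreement at real points near `0` spreads to the imaginary
    -- axis, where the characteristic functions live.
    refine AnalyticOnNhd.eqOn_of_preconnected_of_frequently_eq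
      (analyticOnNhd_complexMGF.mono (hsub hμ)) (analyticOnNhd_complexMGF.mono (hsub hμ'))
      hconv.isPreconnected (z₀ := 0) (by simp) ?_
    have hreal : ∀ s : ℝ, s < 1 → complexMGF id μ s = complexMGF id μ' s := by
      intro s hs
      rw [complexMGF_ofReal, complexMGF_ofReal]
      exact congrArg _ (h s hs)
    have hfr : ∃ᶠ s : ℝ in 𝓝[≠] 0, complexMGF id μ s = complexMGF id μ' s :=
      (eventually_nhdsWithin_of_eventually_nhds
        ((eventually_lt_nhds (zero_lt_one' ℝ)).mono hreal)).frequently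
    have ht : Tendsto (fun s : ℝ => (s : ℂ)) (𝓝[≠] 0) (𝓝[≠] 0) := by
      refine tendsto_nhdsWithin_iff.2 ⟨?_, ?_⟩
      · exact (Complex.continuous_ofReal.tendsto' 0 0 Complex.ofReal_zero).mono_left
          nhdsWithin_le_nhds
      · filter_upwards [self_mem_nhdsWithin] with s hs
        simpa using hs
    exact ht.frequently hfr
  refine Measure.ext_of_charFun (funext fun t => ?_)
  rw [← complexMGF_id_mul_I, ← complexMGF_id_mul_I]
  exact heq (by simp)

/-- Uniqueness for the Laplace transform. -/
lemma ae_eq_zero_of_laplace_eq_zero {v : ℝ → ℝ}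
    (hv : ∀ r, 0 < r → IntegrableOn (fun t => Real.exp (-r * t) * v t) (Ioi 0))
    (h : ∀ r, 0 < r → ∫ t in Ioi (0 : ℝ), Real.exp (-r * t) * v t = 0) :
    v =ᵐ[volume.restrict (Ioi 0)] 0 := by
  -- The tilt by `exp (-t)` makes `w` integrable and its moment generating function finite on `s <
  -- 1`, so that `0` is an interior point.
  set w : ℝ → ℝ := fun t => Real.exp (-1 * t) * v t with hw
  have hwi := hv 1 one_pos
  have hexp : ∀ s t : ℝ, Real.exp (s * t) * w t = Real.exp (-(1 - s) * t) * v t := by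
    intro s t
    rw [hw, ← mul_assoc, ← Real.exp_add]; ring_nf
  have hp : ∀ u : ℝ → ℝ, IntegrableOn u (Ioi 0) → (∀ s < 1,
      IntegrableOn (fun t => Real.exp (s * t) * u t) (Ioi 0)) → ∀ s < 1,
      IntegrableOn (fun t => (ENNReal.ofReal (u t)).toReal * Real.exp (s * t)) (Ioi 0) := by
    intro u hu hu' s hs
    refine Integrable.mono (hu' s hs) (AEStronglyMeasurable.mul ?_ (by fun_prop))
      (Eventually.of_forall fun t => ?_)
    · exact hu.aestronglyMeasurable.aemeasurable.ennreal_ofReal.ennreal_toReal.aestronglyMeasurable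
    · rw [norm_mul, norm_mul, mul_comm]
      gcongr
      rw [ENNReal.toReal_ofReal', Real.norm_of_nonneg (le_max_right _ _)]
      exact max_le (le_abs_self _) (abs_nonneg _)
  have hfin : ∀ u : ℝ → ℝ, ∀ᵐ t ∂volume.restrict (Ioi (0 : ℝ)), ENNReal.ofReal (u t) < ⊤ :=
    fun u => Eventually.of_forall fun t => ENNReal.ofReal_lt_top
  have hws : ∀ s < 1, IntegrableOn (fun t => Real.exp (s * t) * w t) (Ioi 0) := fun s hs => by
    simp_rw [hexp]; exact hv (1 - s) (by linarith)
  have hws' : ∀ s < 1, IntegrableOn (fun t => Real.exp (s * t) * (-w) t) (Ioi 0) := fun s hs => by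
    simpa using (hws s hs).neg
  have m1 : AEMeasurable (fun t => ENNReal.ofReal (w t)) (volume.restrict (Ioi 0)) :=
    hwi.aestronglyMeasurable.aemeasurable.ennreal_ofReal
  have m2 : AEMeasurable (fun t => ENNReal.ofReal ((-w) t)) (volume.restrict (Ioi 0)) :=
    hwi.neg.aestronglyMeasurable.aemeasurable.ennreal_ofReal
  have i1 := hp w hwi hws
  have i2 := hp (-w) hwi.neg hws'
  have := isFiniteMeasure_withDensity_ofReal hwi.2
  have := isFiniteMeasure_withDensity_ofReal hwi.neg.2
  -- The positive and negative parts of `w` are densities of finite measures with the same moment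
  -- generating function, hence of the same measure.
  have key : (volume.restrict (Ioi (0 : ℝ))).withDensity (fun t => ENNReal.ofReal (w t)) =
      (volume.restrict (Ioi (0 : ℝ))).withDensity (fun t => ENNReal.ofReal ((-w) t)) := by
    refine measure_eq_of_mgf_eq_of_lt_one (fun s hs => ?_) (fun s hs => ?_) (fun s hs => ?_)
    · rw [integrable_withDensity_iff_integrable_smul₀' m1 (hfin w)]
      exact i1 s hs
    · rw [integrable_withDensity_iff_integrable_smul₀' m2 (hfin (-w))]
      exact i2 s hs
    · rw [integral_withDensity_eq_integral_toReal_smul₀ m1 (hfin w),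
        integral_withDensity_eq_integral_toReal_smul₀ m2 (hfin (-w)), ← sub_eq_zero]
      simp only [smul_eq_mul]
      rw [← integral_sub (i1 s hs) (i2 s hs)]
      refine Eq.trans (integral_congr_ae (Eventually.of_forall fun t => ?_))
        (h (1 - s) (by linarith))
      beta_reduce
      rw [← hexp, ENNReal.toReal_ofReal', ENNReal.toReal_ofReal', ← sub_mul, Pi.neg_apply,
        max_zero_sub_max_neg_zero_eq_self, mul_comm]
  have hne : ∫⁻ t in Ioi (0 : ℝ), ENNReal.ofReal (w t) ≠ ⊤ := by
    refine ne_top_of_le_ne_top hwi.2.ne (lintegral_mono fun t => ?_)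
    exact Real.ofReal_le_enorm _
  filter_upwards [(withDensity_eq_iff m1 m2 hne).1 key] with t ht
  have h1 := congrArg ENNReal.toReal ht
  rw [ENNReal.toReal_ofReal', ENNReal.toReal_ofReal', ← sub_eq_zero, Pi.neg_apply,
    max_zero_sub_max_neg_zero_eq_self] at h1
  exact (mul_eq_zero.1 h1).resolve_left (Real.exp_pos _).ne'

/-! ### Fractional integrals in time and their Laplace transforms. -/

section
variable {f : ℝ → ℝ} {C μ : ℝ} (hf : ContinuousOn f (Ioi 0)) (hb : ∀ t, 0 < t → |f t| ≤ C)
  (hμ : μ < 1)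

include hf hb in
lemma integrableOn_exp_neg_mul_of_bounded {r : ℝ} (hr : 0 < r) :
    IntegrableOn (fun t => Real.exp (-r * t) * f t) (Ioi 0) := by
  refine Integrable.mul_bdd (c := C) (integrableOn_exp_mul_Ioi (neg_neg_of_pos hr) 0)
    (hf.aestronglyMeasurable measurableSet_Ioi) ?_
  filter_upwards [ae_restrict_mem measurableSet_Ioi] with t ht
  exact hb t ht

include hf hb hμ in
lemma intervalIntegrable_sub_rpow_mul {t : ℝ} (ht : 0 < t) :
    IntervalIntegrable (fun s => (t - s) ^ (-μ) * f s) volume 0 t := by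
  have h1 : IntervalIntegrable (fun s : ℝ => (t - s) ^ (-μ)) volume 0 t := by
    have := (intervalIntegral.intervalIntegrable_rpow' (a := 0) (b := t) (r := -μ)
      (by linarith)).comp_sub_left t
    simpa using this.symm
  rw [intervalIntegrable_iff_integrableOn_Ioc_of_le ht.le] at h1 ⊢
  refine Integrable.mul_bdd (c := C) h1
    ((hf.mono Ioc_subset_Ioi_self).aestronglyMeasurable measurableSet_Ioc) ?_
  filter_upwards [ae_restrict_mem measurableSet_Ioc] with s hs
  exact hb s hs.1

include hf hb hμ in
-- Substituting `s = t u` fixes the singularity at `u = 1`, after which dominated convergence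
-- applies.
lemma continuousOn_integral_sub_rpow_mul :
    ContinuousOn (fun t => ∫ s in (0 : ℝ)..t, (t - s) ^ (-μ) * f s) (Ioi 0) := by
  have e : ∀ t ∈ Ioi (0 : ℝ), (∫ s in (0 : ℝ)..t, (t - s) ^ (-μ) * f s) =
      t * t ^ (-μ) * ∫ u in (0 : ℝ)..1, (1 - u) ^ (-μ) * f (t * u) := by
    intro t ht
    have ht : 0 < t := ht
    have := intervalIntegral.smul_integral_comp_mul_left (a := 0) (b := 1)
      (fun s => (t - s) ^ (-μ) * f s) t
    rw [mul_zero, mul_one] at this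
    rw [← this, smul_eq_mul, mul_assoc, ← intervalIntegral.integral_const_mul (t ^ (-μ))]
    congr 1
    refine intervalIntegral.integral_congr fun u hu => ?_
    rw [uIcc_of_le zero_le_one] at hu
    rw [show t - t * u = t * (1 - u) by ring, Real.mul_rpow ht.le (by linarith [hu.2])]
    ring
  refine ContinuousOn.congr ?_ e
  refine ContinuousOn.mul (continuousOn_id.mul fun t ht =>
    (Real.continuousAt_rpow_const _ _ (Or.inl (ne_of_gt ht))).continuousWithinAt) ?_
  intro t ht
  refine ContinuousAt.continuousWithinAt ?_
  have hbi : IntervalIntegrable (fun u : ℝ => (1 - u) ^ (-μ) * C) volume 0 1 := by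
    have := (intervalIntegral.intervalIntegrable_rpow' (a := 0) (b := 1) (r := -μ)
      (by linarith)).comp_sub_left 1
    simpa using (this.symm).mul_const C
  refine intervalIntegral.continuousAt_of_dominated_interval
    (bound := fun u => (1 - u) ^ (-μ) * C) ?_ ?_ hbi ?_
  · filter_upwards [Ioi_mem_nhds ht] with y hy
    rw [uIoc_of_le zero_le_one]
    refine AEStronglyMeasurable.mul (Measurable.aestronglyMeasurable (by fun_prop)) ?_
    refine ContinuousOn.aestronglyMeasurable (hf.comp (by fun_prop) fun u hu => ?_)
      measurableSet_Ioc
    exact mul_pos hy hu.1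
  · filter_upwards [Ioi_mem_nhds ht] with y hy
    refine Eventually.of_forall fun u hu => ?_
    rw [uIoc_of_le zero_le_one] at hu
    have : 0 ≤ 1 - u := by linarith [hu.2]
    rw [norm_mul, Real.norm_of_nonneg (by positivity)]
    gcongr
    exact hb _ (mul_pos hy hu.1)
  · refine Eventually.of_forall fun u hu => ?_
    rw [uIoc_of_le zero_le_one] at hu
    refine continuousAt_const.mul ?_
    exact ContinuousAt.comp (f := fun x => x * u)
      (hf.continuousAt (Ioi_mem_nhds (mul_pos ht hu.1))) (by fun_prop)

include hf hb hμ in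
/-- The Laplace transform of a fractional integral. -/
lemma integral_exp_neg_mul_integral_sub_rpow {r : ℝ} (hr : 0 < r) :
    IntegrableOn (fun t => Real.exp (-r * t) * ∫ s in (0 : ℝ)..t, (t - s) ^ (-μ) * f s) (Ioi 0) ∧
    ∫ t in Ioi (0 : ℝ), Real.exp (-r * t) * ∫ s in (0 : ℝ)..t, (t - s) ^ (-μ) * f s =
      Real.Gamma (1 - μ) * r ^ (μ - 1) * ∫ t in Ioi (0 : ℝ), Real.exp (-r * t) * f t := by
  have h1 := integrableOn_exp_neg_mul_of_bounded hf hb hr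
  have h2 : IntegrableOn (fun t : ℝ => Real.exp (-r * t) * t ^ (-μ)) (Ioi 0) := by
    have := integrableOn_rpow_mul_exp_neg_mul_rpow (s := -μ) (p := 1) (by linarith) one_pos hr
    simpa only [Real.rpow_one, mul_comm] using this
  -- Splitting `exp (-r t) = exp (-r s) exp (-r (t - s))` exhibits the weighted integral as a
  -- convolution.
  have e : ∀ t : ℝ, (∫ s in (0 : ℝ)..t, (ContinuousLinearMap.mul ℝ ℝ (Real.exp (-r * s) * f s))
      (Real.exp (-r * (t - s)) * (t - s) ^ (-μ))) =
      Real.exp (-r * t) * ∫ s in (0 : ℝ)..t, (t - s) ^ (-μ) * f s := by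
    intro t
    rw [← intervalIntegral.integral_const_mul]
    refine intervalIntegral.integral_congr fun s _ => ?_
    simp only [ContinuousLinearMap.mul_apply']
    rw [show -r * t = -r * s + -r * (t - s) by ring, Real.exp_add]
    ring
  have hi := integrable_posConvolution (μ := volume) (ν := volume) h1 h2
    (ContinuousLinearMap.mul ℝ ℝ)
  have hv := integral_posConvolution (μ := volume) (ν := volume) h1 h2
    (ContinuousLinearMap.mul ℝ ℝ)
  have hG : ∫ t in Ioi (0 : ℝ), Real.exp (-r * t) * t ^ (-μ) =
      Real.Gamma (1 - μ) * r ^ (μ - 1) := by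
    have := Real.integral_rpow_mul_exp_neg_mul_Ioi (a := 1 - μ) (by linarith) hr
    rw [one_div, Real.inv_rpow hr.le, ← Real.rpow_neg hr.le, neg_sub] at this
    rw [mul_comm (Real.Gamma _), ← this]
    refine setIntegral_congr_fun measurableSet_Ioi fun t _ => ?_
    rw [mul_comm]; ring_nf
  constructor
  · rw [posConvolution, integrable_indicator_iff measurableSet_Ioi] at hi
    exact hi.congr_fun (fun t _ => e t) measurableSet_Ioi
  · simp_rw [e] at hv
    rw [hv, hG, ContinuousLinearMap.mul_apply', mul_comm]

end

lemma contDiffAt_one_of_hasDerivAt {f g : ℝ → ℝ} {U : Set ℝ} {t : ℝ} (hU : U ∈ 𝓝 t)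
    (hd : ∀ y ∈ U, HasDerivAt f (g y) y) (hg : ContinuousOn g U) : ContDiffAt ℝ 1 f t := by
  refine contDiffAt_one_iff.2 ⟨fun y => ContinuousLinearMap.toSpanSingleton ℝ (g y), U, hU, ?_,
    fun y hy => (hd y hy).hasFDerivAt⟩
  exact (ContinuousLinearMap.toSpanSingletonCLE (𝕜 := ℝ) (E := ℝ)).continuous.comp_continuousOn hg

/-! ### The fractional equation and the boundary values. -/

section
variable {a γ ν x : ℝ} (h0 : 0 < a) (h1 : a < 1)
include h0 h1

lemma continuousOn_wrightRay_right (hγ : 0 < γ) : ContinuousOn (wrightRay a γ x) (Ioi 0) :=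
  fun _ ht => (hasDerivAt_wrightRay_right h0 h1 hγ x ht).continuousAt.continuousWithinAt

/-- The fractional integral of order `1 - ν` of the density in time. -/
lemma inv_Gamma_mul_integral_wrightRay (hν0 : 0 < ν) (hν : ν < 1) (hx : 0 < x) {t : ℝ}
    (ht : 0 < t) :
    (Real.Gamma (1 - ν))⁻¹ * ∫ s in (0 : ℝ)..t, (t - s) ^ (-ν) * wrightRay a a x s =
      ∫ s in (0 : ℝ)..t, wrightRay a (a + ν) x s := by
  have haν : 0 < a + ν := by linarith
  obtain ⟨C₁, hC₁⟩ := exists_abs_wrightRay_le_of_pos h0 h1 h0 hx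
  obtain ⟨C₂, hC₂⟩ := exists_abs_wrightRay_le_of_pos h0 h1 haν hx
  have c1 := continuousOn_wrightRay_right (x := x) h0 h1 h0
  have c2 := continuousOn_wrightRay_right (x := x) h0 h1 haν
  have b1 : ∀ t, 0 < t → |wrightRay a a x t| ≤ C₁ := fun t ht => hC₁ t ht.le
  have b2 : ∀ t, 0 < t → |wrightRay a (a + ν) x t| ≤ C₂ := fun t ht => hC₂ t ht.le
  have hG : Real.Gamma (1 - ν) ≠ 0 := (Real.Gamma_pos_of_pos (by linarith)).ne'
  set P : ℝ → ℝ := fun t => ∫ s in (0 : ℝ)..t, (t - s) ^ (-ν) * wrightRay a a x s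
  -- The plain integral is written with kernel exponent `0`, so that the lemmas on fractional
  -- integrals cover both sides.
  set Q : ℝ → ℝ := fun t => ∫ s in (0 : ℝ)..t, (t - s) ^ (-(0 : ℝ)) * wrightRay a (a + ν) x s
    with hQ
  have hPr := fun r (hr : 0 < r) => integral_exp_neg_mul_integral_sub_rpow c1 b1 hν hr
  have hQr := fun r (hr : 0 < r) => integral_exp_neg_mul_integral_sub_rpow c2 b2 one_pos hr
  have hsplit : ∀ r t : ℝ, Real.exp (-r * t) * ((Real.Gamma (1 - ν))⁻¹ * P t - Q t) =
      (Real.Gamma (1 - ν))⁻¹ * (Real.exp (-r * t) * P t) - Real.exp (-r * t) * Q t :=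
    fun r t => by ring
  have hae := ae_eq_zero_of_laplace_eq_zero (v := fun t => (Real.Gamma (1 - ν))⁻¹ * P t - Q t)
    (fun r hr => by
      simp_rw [hsplit]
      exact ((hPr r hr).1.const_mul _).sub (hQr r hr).1)
    (fun r hr => by
      simp_rw [hsplit]
      rw [integral_sub ((hPr r hr).1.const_mul _) (hQr r hr).1, integral_const_mul,
        (hPr r hr).2, (hQr r hr).2, integral_exp_neg_mul_wrightRay h0 h1 h0 hx hr,
        integral_exp_neg_mul_wrightRay h0 h1 haν hx hr, sub_zero, Real.Gamma_one, one_mul]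
      -- The two transforms agree because both exponents sum to `a + ν - 2`.
      have e : r ^ (ν - 1) * r ^ (a - 1) = r ^ ((0 : ℝ) - 1) * r ^ (a + ν - 1) := by
        rw [← Real.rpow_add hr, ← Real.rpow_add hr]; ring_nf
      rw [mul_assoc, inv_mul_cancel_left₀ hG, ← mul_assoc, e]
      ring)
  have hcont : ContinuousOn (fun t => (Real.Gamma (1 - ν))⁻¹ * P t - Q t) (Ioi 0) :=
    ((continuousOn_integral_sub_rpow_mul c1 b1 hν).const_smul (Real.Gamma (1 - ν))⁻¹).sub
      (continuousOn_integral_sub_rpow_mul c2 b2 one_pos)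
  -- Both sides are continuous in `t`, which upgrades equality almost everywhere to every `t > 0`.
  have := Measure.eqOn_open_of_ae_eq hae isOpen_Ioi hcont continuousOn_const ht
  have hQt : Q t = ∫ s in (0 : ℝ)..t, wrightRay a (a + ν) x s := by simp [hQ]
  rw [← hQt]
  simpa [sub_eq_zero] using this

lemma hasDerivAt_integral_wrightRay (hγ : 0 < γ) (hx : 0 < x) {t : ℝ} (ht : 0 < t) :
    HasDerivAt (fun u => ∫ s in (0 : ℝ)..u, wrightRay a γ x s) (wrightRay a γ x t) t := by
  obtain ⟨C, hC⟩ := exists_abs_wrightRay_le_of_pos h0 h1 hγ hx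
  have c := continuousOn_wrightRay_right (x := x) h0 h1 hγ
  have hi := intervalIntegrable_sub_rpow_mul (μ := 0) c (fun t ht => hC t (le_of_lt ht)) one_pos ht
  simp only [neg_zero, Real.rpow_zero, one_mul] at hi
  exact intervalIntegral.integral_hasDerivAt_right hi
    (c.stronglyMeasurableAtFilter isOpen_Ioi t ht) (c.continuousAt (Ioi_mem_nhds ht))

lemma rlDeriv_invStableDensity (hν0 : 0 < ν) (hν1 : ν ≤ 1) (hx : 0 < x) {t : ℝ} (ht : 0 < t) :
    RLDifferentiableAt ν (fun s => invStableDensity a x s) t ∧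
      rlDeriv ν (fun s => invStableDensity a x s) t = wrightRay a (a + ν) x t := by
  have hceil : ⌈ν⌉₊ = 1 := by
    rw [Nat.ceil_eq_iff one_ne_zero]
    simpa using ⟨hν0, hν1⟩
  have haν : 0 < a + ν := by linarith
  have hd : ∀ y ∈ Ioi (0 : ℝ), HasDerivAt (rlPrimitive ν (fun s => invStableDensity a x s))
      (wrightRay a (a + ν) x y) y := by
    intro y hy
    have hy : 0 < y := hy
    rcases hν1.eq_or_lt with rfl | hν
    · refine (hasDerivAt_wrightRay_right h0 h1 h0 x hy).congr_of_eventuallyEq ?_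
      filter_upwards [Ioi_mem_nhds hy] with z hz
      rw [rlPrimitive, hceil, if_pos (by simp), invStableDensity_eq_wrightRay h0 h1 x hz]
    · refine (hasDerivAt_integral_wrightRay h0 h1 haν hx hy).congr_of_eventuallyEq ?_
      filter_upwards [Ioi_mem_nhds hy] with z hz
      have hz : 0 < z := hz
      rw [rlPrimitive, hceil, if_neg (by simpa using hν.ne),
        ← inv_Gamma_mul_integral_wrightRay h0 h1 hν0 hν hx hz]
      rw [Nat.cast_one, show (1 : ℝ) - ν - 1 = -ν by ring]
      congr 1
      -- The ray representation holds only for `s > 0`, so the endpoint `s = 0` has to be excluded.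
      refine intervalIntegral.integral_congr_ae (Eventually.of_forall fun s hs => ?_)
      rw [uIoc_of_le hz.le] at hs
      rw [invStableDensity_eq_wrightRay h0 h1 x hs.1]
  refine ⟨⟨fun hne => ?_, ?_⟩, ?_⟩
  · rw [hceil] at hne ⊢
    have hν : ν < 1 := lt_of_le_of_ne hν1 (by simpa using hne)
    filter_upwards [Ioi_mem_nhds ht] with y hy
    have hy : 0 < y := hy
    obtain ⟨C, hC⟩ := exists_abs_wrightRay_le_of_pos h0 h1 h0 hx
    have hi := intervalIntegrable_sub_rpow_mul (continuousOn_wrightRay_right (x := x) h0 h1 h0)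
      (fun t ht => hC t (le_of_lt ht)) hν hy
    rw [Nat.cast_one, show (1 : ℝ) - ν - 1 = -ν by ring]
    refine hi.congr fun s hs => ?_
    rw [uIoc_of_le hy.le] at hs
    simp only [invStableDensity_eq_wrightRay h0 h1 x hs.1]
  · rw [hceil]
    exact contDiffAt_one_of_hasDerivAt (Ioi_mem_nhds ht) hd
      (continuousOn_wrightRay_right h0 h1 haν)
  · rw [rlDeriv, hceil, iteratedDeriv_one]
    exact (hd t ht).deriv

lemma minusDeriv_invStableDensity (k : ℕ) (y : ℝ) {t : ℝ} (ht : 0 < t) :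
    minusDeriv k (fun y => invStableDensity a y t) y = wrightRay a (a + k * a) y t := by
  rw [minusDeriv, funext fun y => invStableDensity_eq_wrightRay h0 h1 y ht,
    iteratedDeriv_wrightRay_left h0 h1 h0 ht, ← mul_assoc, ← mul_pow]
  simp

lemma contDiff_invStableDensity (n : ℕ) {t : ℝ} (ht : 0 < t) :
    ContDiff ℝ n (fun y => invStableDensity a y t) := by
  rw [funext fun y => invStableDensity_eq_wrightRay h0 h1 y ht]
  exact contDiff_wrightRay_left h0 h1 h0 ht (m := (n : ℕ∞))

lemma tendsto_minusDeriv_invStableDensity (k : ℕ) {t : ℝ} (ht : 0 < t) :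
    Tendsto (fun x => minusDeriv k (fun y => invStableDensity a y t) x) (𝓝[>] 0)
      (𝓝 (fracPhi (a + k * a) t)) := by
  have hk : 0 < a + k * a := by positivity
  rw [← wrightRay_zero_eq_fracPhi h0 h1 hk ht,
    funext fun x => minusDeriv_invStableDensity h0 h1 k x ht]
  exact (hasDerivAt_wrightRay_left h0 h1 hk ht 0).continuousAt.tendsto.mono_left nhdsWithin_le_nhds

end

/-! ### Tails of the density and one-dimensional laws with a stable Laplace transform. -/

section tail
variable {a : ℝ} (h0 : 0 < a) (h1 : a < 1)
include h0 h1

lemma integral_Ioi_wrightM_eq {z : ℝ} (hz : 0 ≤ z) :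
    ∫ y in Ioi z, wrightM a y = 1 - ∫ y in (0 : ℝ)..z, wrightM a y := by
  have := intervalIntegral.integral_Ioi_sub_Ioi (integrableOn_wrightM h0 h1) hz
  rw [integral_wrightM h0 h1] at this
  linarith

lemma hasDerivAt_one_sub_integral_wrightM (z : ℝ) :
    HasDerivAt (fun z => 1 - ∫ y in (0 : ℝ)..z, wrightM a y) (-wrightM a z) z :=
  ((continuous_wrightM h0 h1).integral_hasStrictDerivAt 0 z).hasDerivAt.const_sub 1

lemma tail_eq {x t : ℝ} (hx : 0 ≤ x) (ht : 0 < t) :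
    ∫ y in Ioi x, invStableDensity a y t =
      1 - ∫ y in (0 : ℝ)..(x * t ^ (-a)), wrightM a y := by
  rw [integral_Ioi_invStableDensity a x ht, integral_Ioi_wrightM_eq h0 h1 (by positivity)]

end tail

section law
variable {Ω : Type*} [MeasurableSpace Ω] {P : Measure Ω} [IsProbabilityMeasure P]

/-- The Laplace transform of a distribution function. -/
lemma integral_exp_neg_mul_measureReal_le {X : Ω → ℝ} (hX : Measurable X) (hX0 : ∀ᵐ ω ∂P, 0 ≤ X ω)
    {r : ℝ} (hr : 0 < r) :
    IntegrableOn (fun t => Real.exp (-r * t) * P.real {ω | X ω ≤ t}) (Ioi 0) ∧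
    ∫ t in Ioi (0 : ℝ), Real.exp (-r * t) * P.real {ω | X ω ≤ t} =
      r⁻¹ * ∫ ω, Real.exp (-r * X ω) ∂P := by
  set F : ℝ × Ω → ℝ := {p : ℝ × Ω | X p.2 ≤ p.1}.indicator fun p => Real.exp (-r * p.1) with hF
  have hS : MeasurableSet {p : ℝ × Ω | X p.2 ≤ p.1} :=
    measurableSet_le (hX.comp measurable_snd) measurable_fst
  have hFi : Integrable F ((volume.restrict (Ioi 0)).prod P) := by
    have h := ((integrableOn_exp_mul_Ioi (neg_neg_of_pos hr) 0).mul_prod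
      (integrable_const (μ := P) (1 : ℝ)))
    simp only [mul_one] at h
    exact h.indicator hS
  have e : ∀ t : ℝ, ∫ ω, F (t, ω) ∂P = Real.exp (-r * t) * P.real {ω | X ω ≤ t} := by
    intro t
    have : (fun ω => F (t, ω)) = {ω | X ω ≤ t}.indicator fun _ => Real.exp (-r * t) := by
      ext ω; simp [hF, indicator]
    rw [this, integral_indicator_const _ (measurableSet_le hX measurable_const), smul_eq_mul,
      mul_comm]
  constructor
  · have := hFi.integral_prod_left
    simp_rw [e] at this
    exact this
  · simp_rw [← e]
    rw [integral_integral_swap (f := fun t ω => F (t, ω)) hFi, ← integral_const_mul]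
    refine integral_congr_ae ?_
    filter_upwards [hX0] with ω hω
    have : (fun t => F (t, ω)) = (Ici (X ω)).indicator fun t => Real.exp (-r * t) := by
      ext t; simp [hF, indicator]
    rw [this, setIntegral_indicator measurableSet_Ici]
    have hs : (Ioi (0 : ℝ) ∩ Ici (X ω) : Set ℝ) =ᵐ[volume] Ioi (X ω) := by
      have h2 : (Ioi (0 : ℝ) ∩ Ici (X ω) : Set ℝ) =ᵐ[volume] (Ioi 0 ∩ Ioi (X ω) : Set ℝ) :=
        (ae_eq_refl _).inter Ioi_ae_eq_Ici.symm
      rwa [Ioi_inter_Ioi, max_eq_right hω] at h2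
    rw [setIntegral_congr_set hs, integral_exp_mul_Ioi (neg_neg_of_pos hr)]
    field_simp

/-- As functions of `t` both sides have Laplace transform `r⁻¹ exp (-x r ^ a)`, so they agree almost
everywhere; right-continuity then gives every `t > 0`. -/
lemma measureReal_le_eq_tail {a x : ℝ} (h0 : 0 < a) (h1 : a < 1) (hx : 0 ≤ x) {X : Ω → ℝ}
    (hX : Measurable X) (hX0 : ∀ᵐ ω ∂P, 0 ≤ X ω)
    (hL : ∀ r, 0 < r → ∫ ω, Real.exp (-r * X ω) ∂P = Real.exp (-x * r ^ a)) {t : ℝ} (ht : 0 < t) :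
    P.real {ω | X ω ≤ t} = ∫ y in Ioi x, invStableDensity a y t := by
  set T : ℝ → ℝ := fun t => ∫ y in Ioi x, invStableDensity a y t with hT
  set G : ℝ → ℝ := fun t => P.real {ω | X ω ≤ t} with hG
  have hTi : ∀ r, 0 < r → IntegrableOn (fun t => Real.exp (-r * t) * T t) (Ioi 0) := by
    intro r hr
    have := ((integrable_exp_mul_invStableDensity h0 h1 hr).mono_measure
      (Measure.prod_mono le_rfl (Measure.restrict_mono (Ioi_subset_Ioi hx)
        le_rfl))).integral_prod_left
    simp only [Function.uncurry, integral_const_mul] at this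
    exact this
  have hae := ae_eq_zero_of_laplace_eq_zero (v := fun t => G t - T t)
    (fun r hr => by
      simp_rw [mul_sub]
      exact (integral_exp_neg_mul_measureReal_le hX hX0 hr).1.sub (hTi r hr))
    (fun r hr => by
      simp_rw [mul_sub]
      rw [integral_sub (integral_exp_neg_mul_measureReal_le hX hX0 hr).1 (hTi r hr),
        (integral_exp_neg_mul_measureReal_le hX hX0 hr).2, hL r hr,
        integral_exp_neg_mul_tail h0 h1 hx hr, sub_self])
  have : IsProbabilityMeasure (P.map X) := Measure.isProbabilityMeasure_map hX.aemeasurable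
  have hGc : ContinuousWithinAt G (Ioi t) t := by
    have : G = cdf (P.map X) := by
      ext t
      rw [cdf_eq_real, map_measureReal_apply hX measurableSet_Iic]
      rfl
    rw [this]
    exact ((cdf (P.map X)).right_continuous t).mono Ioi_subset_Ici_self
  have hTc : ContinuousWithinAt T (Ioi t) t := by
    have hc : ContinuousAt (fun t => 1 - ∫ y in (0 : ℝ)..(x * t ^ (-a)), wrightM a y) t :=
      ContinuousAt.comp (f := fun t : ℝ => x * t ^ (-a))
        (hasDerivAt_one_sub_integral_wrightM h0 h1 _).continuousAt
        (continuousAt_const.mul (Real.continuousAt_rpow_const _ _ (Or.inl ht.ne')))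
    refine (hc.congr ?_).continuousWithinAt
    filter_upwards [Ioi_mem_nhds ht] with s hs
    exact (tail_eq h0 h1 hx hs).symm
  -- Every interval `(t, u)` has positive measure, so it contains points where the two sides agree.
  have hfr : ∃ᶠ s in 𝓝[>] t, G s - T s ∈ ({0} : Set ℝ) := by
    have h2 : ∀ᵐ s, s ∈ Ioi (0 : ℝ) → G s - T s = 0 := (ae_restrict_iff' measurableSet_Ioi).1 hae
    rw [Filter.Frequently]
    intro hev
    obtain ⟨u, hu, hsub⟩ := mem_nhdsGT_iff_exists_Ioo_subset.1 hev
    have hu : t < u := hu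
    have hz : volume (Ioo t u) = 0 := by
      refine measure_mono_null (fun s hs => ?_) h2
      have hns : ¬ (G s - T s ∈ ({0} : Set ℝ)) := hsub hs
      exact fun hcontra => hns (hcontra (ht.trans hs.1))
    rw [Real.volume_Ioo, ENNReal.ofReal_eq_zero] at hz
    linarith
  have := isClosed_singleton.mem_of_frequently_of_tendsto hfr (hGc.sub hTc)
  exact sub_eq_zero.1 this

end law

/-! ### The stable subordinator and the law of its inverse. -/

section subordinator
variable {Ω : Type*} [MeasurableSpace Ω] {P : Measure Ω} {a : ℝ} {H : ℝ≥0 → Ω → ℝ}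

lemma IsStableSubordinator.ae_nonneg (hH : IsStableSubordinator a H P) :
    ∀ᵐ ω ∂P, ∀ x, 0 ≤ H x ω := by
  filter_upwards [hH.start_zero, hH.paths] with ω h1 h2 x
  rw [← h1]
  exact h2.1 zero_le

variable [IsProbabilityMeasure P]

/-- Chernoff's bound with `E exp (-H(k)) = exp (-k)`. It makes the set defining `L(t)` nonempty
almost surely; on the empty set `sInf` would return `0`. -/
lemma IsStableSubordinator.ae_unbounded (hH : IsStableSubordinator a H P) (t : ℝ) :
    ∀ᵐ ω ∂P, ∃ x, t < H x ω := by
  have hle : ∀ k : ℕ, P.real {ω | ∀ x, H x ω ≤ t} ≤ Real.exp t * Real.exp (-(k : ℝ)) := by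
    intro k
    have hi : Integrable (fun ω => Real.exp (-1 * H k ω)) P := by
      refine Integrable.of_bound (C := 1) (by have := hH.measurable k; fun_prop) ?_
      filter_upwards [hH.ae_nonneg] with ω hω
      rw [Real.norm_of_nonneg (Real.exp_pos _).le, Real.exp_le_one_iff]
      linarith [hω k]
    have h2 := measure_le_le_exp_mul_mgf t (by norm_num : (-1 : ℝ) ≤ 0) hi
    rw [mgf, hH.laplace k 1 one_pos] at h2
    simp only [neg_neg, one_mul, Real.one_rpow, mul_one, NNReal.coe_natCast] at h2
    exact (measureReal_mono fun ω (hω : ∀ x, H x ω ≤ t) => hω k).trans h2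
  have hz : P.real {ω | ∀ x, H x ω ≤ t} ≤ 0 := by
    have : Tendsto (fun k : ℕ => Real.exp t * Real.exp (-(k : ℝ))) atTop (𝓝 (Real.exp t * 0)) :=
      (Real.tendsto_exp_neg_atTop_nhds_zero.comp tendsto_natCast_atTop_atTop).const_mul _
    rw [mul_zero] at this
    exact ge_of_tendsto' this hle
  have hz' : P {ω | ∀ x, H x ω ≤ t} = 0 :=
    (measureReal_eq_zero_iff).1 (le_antisymm hz measureReal_nonneg)
  have : ∀ᵐ ω ∂P, ω ∉ {ω | ∀ x, H x ω ≤ t} := measure_eq_zero_iff_ae_notMem.1 hz'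
  filter_upwards [this] with ω hω
  simpa using hω

/-- Monotonicity lets a rational slightly above a near-minimiser replace it, so the infimum is
countable and measurability in `ω` follows. The value `⊤` discards rationals outside the set. -/
lemma coe_sInf_eq_iInf_rat {h : ℝ≥0 → ℝ} (hm : Monotone h) {t : ℝ} (hne : ∃ x, t < h x) :
    ((sInf {x : ℝ≥0 | t < h x} : ℝ≥0) : ENNReal) =
      ⨅ q : ℚ, if t < h (Real.toNNReal q) then ((Real.toNNReal q : ℝ≥0) : ENNReal) else ⊤ := by
  refine le_antisymm (le_iInf fun q => ?_) (le_of_forall_gt fun b hb => ?_)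
  · split_ifs with hq
    · exact ENNReal.coe_le_coe.2 (csInf_le (OrderBot.bddBelow _) hq)
    · exact le_top
  · obtain ⟨c, hc, hcb⟩ := ENNReal.lt_iff_exists_nnreal_btwn.1 hb
    obtain ⟨s, hs, hsc⟩ := exists_lt_of_csInf_lt hne (ENNReal.coe_lt_coe.1 hc)
    obtain ⟨q, -, hsq, hqc⟩ := (NNReal.lt_iff_exists_rat_btwn s c).1 hsc
    have hq : t < h (Real.toNNReal q) := lt_of_lt_of_le hs (hm hsq.le)
    refine lt_of_le_of_lt (iInf_le _ q) ?_
    rw [if_pos hq]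
    exact (ENNReal.coe_lt_coe.2 hqc).trans hcb

lemma IsStableSubordinator.aemeasurable_inverseProcess (hH : IsStableSubordinator a H P) (t : ℝ) :
    AEMeasurable (inverseProcess H t) P := by
  refine ⟨fun ω => (⨅ q : ℚ, if t < H (Real.toNNReal q) ω then
    ((Real.toNNReal q : ℝ≥0) : ENNReal) else ⊤).toReal, ?_, ?_⟩
  · exact (Measurable.iInf fun q => Measurable.ite
      (measurableSet_lt measurable_const (hH.measurable _)) measurable_const
      measurable_const).ennreal_toReal
  · filter_upwards [hH.paths, hH.ae_unbounded t] with ω h1 h2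
    rw [inverseProcess, ← coe_sInf_eq_iInf_rat h1.1 h2, ENNReal.coe_toReal]

variable (h0 : 0 < a) (h1 : a < 1)
include h0 h1

lemma IsStableSubordinator.measureReal_le (hH : IsStableSubordinator a H P) (x : ℝ≥0) {t : ℝ}
    (ht : 0 < t) :
    P.real {ω | H x ω ≤ t} = 1 - ∫ y in (0 : ℝ)..(x * t ^ (-a)), wrightM a y := by
  rw [← tail_eq h0 h1 x.coe_nonneg ht]
  exact measureReal_le_eq_tail h0 h1 x.coe_nonneg (hH.measurable x)
    (hH.ae_nonneg.mono fun ω h => h x) (fun r hr => hH.laplace x r hr) ht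

/-- Monotone paths make `P(H(z) ≤ 1) = 1 - ∫_0^z M` decrease in `z`, and its derivative is `-M(z)`.
-/
lemma IsStableSubordinator.wrightM_nonneg (hH : IsStableSubordinator a H P) {z : ℝ} (hz : 0 < z) :
    0 ≤ wrightM a z := by
  have hanti : AntitoneOn (fun z => 1 - ∫ y in (0 : ℝ)..z, wrightM a y) (Ioi 0) := by
    intro y hy z hz hyz
    have hy : 0 < y := hy
    have hz : 0 < z := hz
    have e1 : P.real {ω | H ⟨y, hy.le⟩ ω ≤ 1} = 1 - ∫ u in (0 : ℝ)..(y * 1 ^ (-a)), wrightM a u :=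
      hH.measureReal_le h0 h1 ⟨y, hy.le⟩ one_pos
    have e2 : P.real {ω | H ⟨z, hz.le⟩ ω ≤ 1} = 1 - ∫ u in (0 : ℝ)..(z * 1 ^ (-a)), wrightM a u :=
      hH.measureReal_le h0 h1 ⟨z, hz.le⟩ one_pos
    rw [Real.one_rpow, mul_one] at e1 e2
    beta_reduce
    rw [← e1, ← e2]
    refine ENNReal.toReal_mono (measure_ne_top _ _) (measure_mono_ae ?_)
    filter_upwards [hH.paths] with ω h hω
    exact le_trans (h.1 (show (⟨y, hy.le⟩ : ℝ≥0) ≤ ⟨z, hz.le⟩ from hyz)) hω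
  have := hanti.derivWithin_nonpos (x := z)
  rw [derivWithin_of_isOpen isOpen_Ioi hz,
    (hasDerivAt_one_sub_integral_wrightM h0 h1 z).deriv] at this
  linarith

lemma IsStableSubordinator.invStableDensity_nonneg (hH : IsStableSubordinator a H P) {x t : ℝ}
    (hx : 0 < x) (ht : 0 < t) : 0 ≤ invStableDensity a x t := by
  rw [invStableDensity_eq_wrightM]
  have := hH.wrightM_nonneg h0 h1 (z := x * t ^ (-a)) (by positivity)
  positivity

/-- Up to null sets, `{H(x) ≤ t} ⊆ {L(t) ≥ x} ⊆ {H(y) ≤ t}` for each `y < x`. The probabilities of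
the outer events are continuous in the level, so letting `y ↑ x` closes the gap; `x = 0` is separate
because no such `y` exists. -/
lemma IsStableSubordinator.measureReal_inverseProcess_ge (hH : IsStableSubordinator a H P)
    (x : ℝ≥0) {t : ℝ} (ht : 0 < t) :
    P.real {ω | (x : ℝ) ≤ inverseProcess H t ω} = ∫ y in Ioi (x : ℝ), invStableDensity a y t := by
  rw [tail_eq h0 h1 x.coe_nonneg ht]
  refine le_antisymm ?_ ?_
  · rcases eq_or_ne x 0 with rfl | hx
    · simp
    have hx : (0 : ℝ) < x := by exact_mod_cast pos_iff_ne_zero.2 hx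
    have hc : Tendsto (fun x : ℝ => 1 - ∫ y in (0 : ℝ)..(x * t ^ (-a)), wrightM a y)
        (𝓝[<] (x : ℝ)) (𝓝 (1 - ∫ y in (0 : ℝ)..(x * t ^ (-a)), wrightM a y)) :=
      (ContinuousAt.comp (f := fun x : ℝ => x * t ^ (-a))
        (hasDerivAt_one_sub_integral_wrightM h0 h1 _).continuousAt
        (by fun_prop)).tendsto.mono_left nhdsWithin_le_nhds
    refine ge_of_tendsto hc ?_
    filter_upwards [Ioo_mem_nhdsLT hx] with y hy
    have e : P.real {ω | H ⟨y, hy.1.le⟩ ω ≤ t} =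
        1 - ∫ u in (0 : ℝ)..(y * t ^ (-a)), wrightM a u := hH.measureReal_le h0 h1 ⟨y, hy.1.le⟩ ht
    rw [← e]
    refine measureReal_mono fun ω hω => ?_
    by_contra hlt
    have h2 : (sInf {x : ℝ≥0 | t < H x ω} : ℝ≥0) ≤ ⟨y, hy.1.le⟩ :=
      csInf_le (OrderBot.bddBelow _) (show t < H _ ω from lt_of_not_ge hlt)
    have h3 : inverseProcess H t ω ≤ y := NNReal.coe_le_coe.2 h2
    have h4 : (x : ℝ) ≤ inverseProcess H t ω := hω
    linarith [hy.2]
  · rw [← hH.measureReal_le h0 h1 x ht]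
    refine ENNReal.toReal_mono (measure_ne_top _ _) (measure_mono_ae ?_)
    filter_upwards [hH.paths, hH.ae_unbounded t] with ω h2 h3 hω
    have hω : H x ω ≤ t := hω
    refine NNReal.coe_le_coe.2 (le_csInf h3 fun y hy => ?_)
    by_contra hlt
    have hy : t < H y ω := hy
    linarith [h2.1 (not_le.1 hlt).le]

/-- The density of the inverse of a stable subordinator. -/
lemma IsStableSubordinator.map_inverseProcess (hH : IsStableSubordinator a H P) {t : ℝ}
    (ht : 0 < t) :
    P.map (inverseProcess H t) = (volume.restrict (Ioi (0 : ℝ))).withDensity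
      (fun x => ENNReal.ofReal (invStableDensity a x t)) := by
  have hm := hH.aemeasurable_inverseProcess t
  have : IsProbabilityMeasure (P.map (inverseProcess H t)) := Measure.isProbabilityMeasure_map hm
  refine Measure.ext_of_Ici _ _ fun x => ?_
  rw [Measure.map_apply_of_aemeasurable hm measurableSet_Ici, withDensity_apply _ measurableSet_Ici,
    Measure.restrict_restrict measurableSet_Ici]
  -- As `L(t) ≥ 0`, a level `x` may be replaced by its positive part.
  have e1 : inverseProcess H t ⁻¹' Ici x =
      {ω | ((Real.toNNReal x : ℝ≥0) : ℝ) ≤ inverseProcess H t ω} := by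
    ext ω
    have : 0 ≤ inverseProcess H t ω := NNReal.coe_nonneg _
    simp [this]
  have e2 : (Ici x ∩ Ioi 0 : Set ℝ) =ᵐ[volume] Ioi ((Real.toNNReal x : ℝ≥0) : ℝ) := by
    have h2 : (Ici x ∩ Ioi (0 : ℝ) : Set ℝ) =ᵐ[volume] (Ioi x ∩ Ioi 0 : Set ℝ) :=
      Ioi_ae_eq_Ici.symm.inter (ae_eq_refl _)
    rwa [Ioi_inter_Ioi] at h2
  rw [e1, Measure.restrict_congr_set e2, ← ofReal_measureReal,
    hH.measureReal_inverseProcess_ge h0 h1 _ ht, ofReal_integral_eq_lintegral_ofReal]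
  · exact (integrableOn_invStableDensity h0 h1 ht).mono_set (Ioi_subset_Ioi (NNReal.coe_nonneg _))
  · filter_upwards [ae_restrict_mem measurableSet_Ioi] with y hy
    exact hH.invStableDensity_nonneg h0 h1 ((NNReal.coe_nonneg _).trans_lt hy) ht

end subordinator

theorem mainTheorem1 (ν : ℝ) (n : ℕ) (hν : 0 < ν) (hν1 : ν ≤ 1) (hn : 1 ≤ n)
    (hα : ν / n < 1) :
    -- the function `l_{ν/n}` is the density of the inverse of the `ν/n`-stable subordinator
    (∀ (Ω : Type*) [MeasurableSpace Ω] (P : Measure Ω) [IsProbabilityMeasure P]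
        (H : ℝ≥0 → Ω → ℝ), IsStableSubordinator (ν / n) H P →
        ∀ t : ℝ, 0 < t →
          (∀ x : ℝ, 0 < x → 0 ≤ invStableDensity (ν / n) x t) ∧
          P.map (inverseProcess H t) =
            (volume.restrict (Ioi (0 : ℝ))).withDensity
              (fun x => ENNReal.ofReal (invStableDensity (ν / n) x t))) ∧
    -- the equation, with the existence of the derivatives in it
    (∀ x t : ℝ, 0 < x → 0 < t →
      ContDiffAt ℝ n (fun y => invStableDensity (ν / n) y t) x ∧
      RLDifferentiableAt ν (fun s => invStableDensity (ν / n) x s) t ∧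
      minusDeriv n (fun y => invStableDensity (ν / n) y t) x
        - rlDeriv ν (fun s => invStableDensity (ν / n) x s) t = 0) ∧
    -- the initial condition `l(x, 0) = δ(x)`
    (∀ t : ℝ, 0 < t → IntegrableOn (fun x => invStableDensity (ν / n) x t) (Ioi 0)) ∧
    (∀ φ : ℝ →ᵇ ℝ,
      Tendsto (fun t => ∫ x in Ioi (0 : ℝ), φ x * invStableDensity (ν / n) x t)
        (𝓝[>] 0) (𝓝 (φ 0))) ∧
    -- the boundary conditions
    (∀ t : ℝ, 0 < t → invStableDensity (ν / n) 0 t = fracPhi (ν / n) t) ∧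
    (∀ t : ℝ, 0 < t → ∀ k : ℕ, k < n →
      Tendsto (fun x => minusDeriv k (fun y => invStableDensity (ν / n) y t) x)
        (𝓝[>] 0) (𝓝 (fracPhi (ν * (k + 1) / n) t))) ∧
    -- the double Laplace transform
    (∀ ξ r : ℝ, 0 < ξ → 0 < r →
      Integrable (fun p : ℝ × ℝ =>
          Real.exp (-ξ * p.1) * (Real.exp (-r * p.2) * invStableDensity (ν / n) p.1 p.2))
        ((volume.restrict (Ioi 0)).prod (volume.restrict (Ioi 0))) ∧
      ∫ x in Ioi (0 : ℝ), Real.exp (-ξ * x) *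
          ∫ t in Ioi (0 : ℝ), Real.exp (-r * t) * invStableDensity (ν / n) x t
        = r ^ (ν / n - 1) / (ξ + r ^ (ν / n))) := by
  have hn0 : (0 : ℝ) < n := by exact_mod_cast hn
  have h0 : 0 < ν / n := by positivity
  have hnα : n * (ν / n) = ν := by field_simp
  refine ⟨fun Ω _ P _ H hH t ht => ⟨fun x hx => hH.invStableDensity_nonneg h0 hα hx ht,
    hH.map_inverseProcess h0 hα ht⟩, fun x t hx ht => ?_,
    fun t ht => integrableOn_invStableDensity h0 hα ht,
    tendsto_integral_mul_invStableDensity h0 hα, fun t ht => ?_, fun t ht k _ => ?_,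
    fun ξ r hξ hr => ⟨integrable_exp_mul_exp_mul_invStableDensity h0 hα hξ hr,
      integral_exp_mul_integral_exp_mul_invStableDensity h0 hα hξ hr⟩⟩
  · obtain ⟨hd, he⟩ := rlDeriv_invStableDensity h0 hα hν hν1 hx ht
    refine ⟨(contDiff_invStableDensity h0 hα n ht).contDiffAt, hd, ?_⟩
    -- Both derivatives are members of the same family, with parameters `a + n a` and `a + ν`, equal
    -- because `n a = ν`.
    rw [he, minusDeriv_invStableDensity h0 hα n x ht, hnα, sub_self]
  · rw [invStableDensity_eq_wrightRay h0 hα 0 ht, wrightRay_zero_eq_fracPhi h0 hα h0 ht]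
  · have := tendsto_minusDeriv_invStableDensity h0 hα k ht
    rwa [show ν / n + k * (ν / n) = ν * (k + 1) / n by ring] at this
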